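/- Theorem (the first two computed deflation steps are mixed stable). Let $\mathbb F$ be $\mathbb R$ or $\mathbb C$, $A,B,C,D,E\in\mathbb F^{n\times n}$, and consider the linearization $$\mathbb A-\lambda\mathbb B=\begin{pmatrix}B&0&-I&0\\D&0&0&-I\\0&-I&0&0\\E&0&0&0\end{pmatrix}-\lambda\begin{pmatrix}-A&0&0&0\\-C&-I&0&0\\0&0&-I&0\\0&0&0&-I\end{pmatrix}$$ of $\lambda^4A+\lambda^3B+\lambda^2C+\lambda D+E$. All computations are in floating point arithmetic (standard model: each elementary operation commits a relative error at most $\varepsilon$, sums in any order). "Mildly growing" means nonnegative and bounded by a polynomial in $n$. *First step.* A Householder QR factorization of $E\widetilde\Pi_E$ ($\widetilde\Pi_E$ the permutation from pivoting, by any pivoting strategy) is computed and truncated at the numerical rank $r=\widetilde r_E$: its first $r$ diagonal entries (pivots) are nonzero, and the discarded part (rows $>r$) of each trailing column is at most $\tau$ times each of these $r$ pivots in modulus (if $r=0$, nothing nonzero is discarded). This gives $E\widetilde\Pi_E\approx\widetilde Q_E\binom{\widetilde R_E}{0}$ with computed $\widetilde Q_E$ and an $r\times n$ matrix $\widetilde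 R_E$. Further $\widetilde X=computed(\widetilde Q_E^*D)$, $\widetilde Y=computed(\widetilde Q_E^*C)$, each by explicit multiplication or by successive application of the computed reflectors. An index 1 (resp. 2) denotes the first $r$ (resp. last $n-r$) rows of $\widetilde X$, $\widetilde Y$ and the first $r$ (resp. last $n-r$) columns of $\widetilde Q_E$, $\widehat Q_E$. *Second step.* A Householder QR factorization of $\binom{\widetilde X_2}{\widetilde R_E\widetilde\Pi_E^T}\widetilde\Pi_{A_{22}}$ is computed, with computed factors $\widetilde Q_{A_{22}}$ and $\binom{\widetilde R_{A_{22}}}{0}$, where $\widetilde R_{A_{22}}$ has $\widetilde r_2$ rows and nonzero pivots; what is set to zero in a column of the triangular factor is at most $g(n)\varepsilon$ times the norm of that column, $g$ being a fixed mildly growing function (nothing nonzero is discarded if $g=0$). With $\widetilde Q_{A_{22}}^*=(\widetilde\Omega_1\ \widetilde\Omega_2)$, $\widetilde\Omega_1$ having $n-r$ columns, put $\widetilde N_{[1]}=computed(\widetilde\Omega_1\widetilde Y_2)$, $\widetilde N_{[2]}=computed(\widetilde\Omega_1\widetilde Q_{E,2}^*)$, $\widetilde N_{[3]}=0$, $\widetilde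 N_{[4]}=-\widetilde\Omega_2$. The computed pencil $\widetilde{\mathbb A}-\lambda\widetilde{\mathbb B}$ (block rows of sizes $n,r,n,n$, block columns of sizes $n,n,n,r$) is $$\widetilde{\mathbb A}=\begin{pmatrix}B&0&-I_n&0\\ \widetilde X_1&0&0&-I_r\\0&-I_n&0&0\\ \binom{\widetilde R_{A_{22}}\widetilde\Pi_{A_{22}}^T}{0}&0&0&0\end{pmatrix},\quad \widetilde{\mathbb B}=\begin{pmatrix}-A&0&0&0\\-\widetilde Y_1&-\widetilde Q_{E,1}^*&0&0\\0&0&-I_n&0\\-\widetilde N_{[1]}&-\widetilde N_{[2]}&\widetilde N_{[3]}&\widetilde N_{[4]}\end{pmatrix}.$$ *Claim.* For every $g$ there are mildly growing $f_C,f_D,f_{qr},f_1,f_2,h$, independent of $n,\varepsilon,\tau$, the data and the run, such that whenever $h(n)\varepsilon\le1$ the following holds with $\epsilon_C=f_C(n)\varepsilon$, $\epsilon_D=f_D(n)\varepsilon$, $\epsilon_{qr}=f_{qr}(n)\varepsilon$. There are exactly unitary $\widehat Q_E$, $\widehat Q_{A_{22}}$ with $\|\widetilde Q_E-\widehat Q_E\|_F\le\epsilon_{qr}$,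 $\|\widetilde Q_{A_{22}}-\widehat Q_{A_{22}}\|_F\le\epsilon_{qr}$, and errors such that: 1. $\widetilde X=\widetilde Q_E^*(D+\delta D)=\widehat Q_E^*(D+\Delta D)$ and $\widetilde Y=\widetilde Q_E^*(C+\delta C)=\widehat Q_E^*(C+\Delta C)$, where for every $i$ both $\|\delta C(:,i)\|_2$ and $\|\Delta C(:,i)\|_2$ are at most $\epsilon_C\|C(:,i)\|_2$, and both $\|\delta D(:,i)\|_2$ and $\|\Delta D(:,i)\|_2$ are at most $\epsilon_D\|D(:,i)\|_2$. 2. $(E+\delta E+\Delta E)\widetilde\Pi_E=\widehat Q_E\binom{\widetilde R_E}{0}$ with $\|\delta E(:,i)\|_2\le\epsilon_{qr}\|E(:,i)\|_2$ for every $i$; the first $r$ columns of $\Delta E\,\widetilde\Pi_E$ vanish, and each other column of it has norm at most $\tau\min_{i\le r}\|(E+\delta E)\widetilde\Pi_E(:,i)\|_2$ ($\Delta E=0$ if $r=0$). 3. $\Delta_\Sigma D=\Delta D+\widehat Q_{E,2}\Gamma_1$ and $\Delta_\Sigma E=\delta E+\Delta E+\widehat Q_{E,1}\Gamma_2$, where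 for every $i$ $$\left\|\binom{\Gamma_1}{\Gamma_2}(:,i)\right\|_2\le\epsilon_{qr}\left\|\binom{D+\Delta D}{E+\delta E+\Delta E}(:,i)\right\|_2 .$$ 4. The forward perturbation of $\widetilde{\mathbb B}$ $$\mathcal F=\begin{pmatrix}0&0&0&0\\0&-\delta\widetilde Q_{E,1}^*&0&0\\0&0&0&0\\ \Delta\widetilde N_{[1]}&\Delta\widetilde N_{[2]}&0&\Delta\widetilde N_{[4]}\end{pmatrix}$$ satisfies $\|\delta\widetilde Q_{E,1}^*\|_2\le\epsilon_{qr}$, $\|\Delta\widetilde N_{[4]}\|_2\le\epsilon_{qr}$, $\|\Delta\widetilde N_{[1]}(:,i)\|_2\le f_1(n)\varepsilon\|\widetilde N_{[1]}(:,i)\|_2$ for every $i$, and $\|\Delta\widetilde N_{[2]}\|_2\le f_2(n)\varepsilon\|\widetilde N_{[2]}\|_2$. 5. $\widetilde{\mathbb A}-\lambda(\widetilde{\mathbb B}+\mathcal F)$ is an exactly reduced linearization of $\lambda^4A+\lambda^3B+\lambda^2(C+\Delta C)+\lambda(D+\Delta_\Sigma D)+(E+\Delta_\Sigma E)$. Namely,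 let $\widehat{\mathbb A}-\lambda\widehat{\mathbb B}$ be the linearization (as above) of this polynomial, let $\Pi$ be the permutation that lists the rows in the order $1{:}n+r,\ 2n+1{:}3n,\ n+r+1{:}2n,\ 3n+1{:}4n$, and put $P=(I_{2n+r}\oplus\widehat Q_{A_{22}}^*\oplus I_{n-r})\,\Pi\,(I_n\oplus\widehat Q_E^*\oplus I_n\oplus\widehat Q_E^*)$, $Q=I_{3n}\oplus\widehat Q_E$. Then, for some matrix $S$, $$P\,\widehat{\mathbb A}\,Q=\begin{pmatrix}\widetilde{\mathbb A}&S\\0&0\end{pmatrix},\qquad P\,\widehat{\mathbb B}\,Q=\begin{pmatrix}\widetilde{\mathbb B}+\mathcal F&0\\0&-I_{n-r}\end{pmatrix}.$$ -/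

import Mathlib

noncomputable section

namespace QuarticDeflation

open Matrix

variable {𝕜 : Type*} [RCLike 𝕜]

/-! ### Floating point arithmetic (standard model)

All computations are described relationally: a relation `Fl… input output` says that `output` is a
possible result of the computation when every elementary operation commits a relative error of at
most `ε`, the relative accuracy of one operation in `𝕜` (real or complex) or in `ℝ`. -/

/-- `y` is a rounded value of the exact result `x`: `y = x (1 + δ)` with `|δ| ≤ ε`. -/
def Rnd (ε : ℝ) (x y : 𝕜) : Prop :=
  ∃ δ : 𝕜, ‖δ‖ ≤ ε ∧ y = x * (1 + δ)

/-- `FlTree ε s c`: `c` is the computed sum of the nonempty multiset `s`, the additions being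
carried out in an arbitrary order (an arbitrary summation tree). -/
inductive FlTree (ε : ℝ) : Multiset 𝕜 → 𝕜 → Prop
  | single (a : 𝕜) : FlTree ε {a} a
  | add (s t : Multiset 𝕜) (a b c : 𝕜) :
      FlTree ε s a → FlTree ε t b → Rnd ε (a + b) c → FlTree ε (s + t) c

/-- Computed sum of a possibly empty multiset. -/
def FlSum (ε : ℝ) (s : Multiset 𝕜) (c : 𝕜) : Prop :=
  (s = 0 ∧ c = 0) ∨ FlTree ε s c

/-- `w` is a computed value of `∑ i ∈ S, x i * y i`. -/
def FlDot {ι : Type*} (ε : ℝ) (S : Finset ι) (x y : ι → 𝕜) (w : 𝕜) : Prop :=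
  ∃ p : ι → 𝕜, (∀ i ∈ S, Rnd ε (x i * y i) (p i)) ∧ FlSum ε (S.val.map p) w

/-- The real number `σ` is a computed value of `∑ i ∈ S, |x i|²`. -/
def FlNormSq {ι : Type*} (ε : ℝ) (S : Finset ι) (x : ι → 𝕜) (σ : ℝ) : Prop :=
  ∃ p : ι → ℝ, (∀ i ∈ S, Rnd ε (‖x i‖ ^ 2) (p i)) ∧ FlSum ε (S.val.map p) σ

/-- `Z` is a computed value of the matrix product `X * Y` (conventional multiplication). -/
def FlMatMul {ι κ μ : Type*} [Fintype κ] (ε : ℝ) (X : Matrix ι κ 𝕜) (Y : Matrix κ μ 𝕜)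
    (Z : Matrix ι μ 𝕜) : Prop :=
  ∀ i j, FlDot ε Finset.univ (fun k => X i k) (fun k => Y k j) (Z i j)

/-! ### Householder QR factorization in floating point arithmetic -/

/-- Computed Householder reflector `I - τ v v^*`, acting on the coordinates `≥ k`, that maps the
part `x(k:n)` of the column `x` to `α e_k`. With `s = x_k / |x_k|` (and `s = 1` if `x_k = 0`) the
formulas are `α = - s ‖x(k:n)‖₂`, `v = x(k:n) - α e_k`, `τ = 2 / ‖v‖₂²`. If `x` is already zero
below position `k`, the reflection may be skipped. -/
def FlReflector {n : ℕ} (ε : ℝ) (k : Fin n) (x v : Fin n → 𝕜) (τ : ℝ) (α : 𝕜) : Prop :=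
  ((∀ i, k < i → x i = 0) ∧ v = 0 ∧ τ = 0 ∧ α = x k) ∨
  ((∃ i, k ≤ i ∧ x i ≠ 0) ∧
    ∃ (σ ρ a ν : ℝ) (s : 𝕜),
      FlNormSq ε (Finset.Ici k) x σ ∧ Rnd ε (√σ) ρ ∧
      Rnd ε ‖x k‖ a ∧ (x k = 0 → s = 1) ∧ (x k ≠ 0 → Rnd ε (x k / (a : 𝕜)) s) ∧
      Rnd ε (-(s * (ρ : 𝕜))) α ∧
      (∀ i, i < k → v i = 0) ∧ Rnd ε (x k - α) (v k) ∧ (∀ i, k < i → v i = x i) ∧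
      FlNormSq ε (Finset.Ici k) v ν ∧ Rnd ε (2 / ν) τ)

/-- `y` is the computed value of `(I - τ v v^*) b = b - v (τ (v^* b))`, where `v` is supported on
the coordinates `≥ k`; the coordinates `< k` are not touched. -/
def FlApply {n : ℕ} (ε : ℝ) (k : Fin n) (v : Fin n → 𝕜) (τ : ℝ) (b y : Fin n → 𝕜) : Prop :=
  ∃ (w t : 𝕜) (p : Fin n → 𝕜),
    FlDot ε (Finset.Ici k) (fun i => star (v i)) b w ∧ Rnd ε ((τ : 𝕜) * w) t ∧
    (∀ i, k ≤ i → Rnd ε (v i * t) (p i) ∧ Rnd ε (b i - p i) (y i)) ∧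
    (∀ i, i < k → y i = b i)

/-- `m` steps of the Householder QR factorization of `M`: the computed reflectors are given by
`v k`, `τ k` for `k < m`, and `T` is the final reduced matrix (zero below the diagonal in its first
`m` columns). -/
def FlHouseholderQR {n : ℕ} (ε : ℝ) (m : ℕ) (M : Matrix (Fin n) (Fin n) 𝕜)
    (v : Fin n → Fin n → 𝕜) (τ : Fin n → ℝ) (T : Matrix (Fin n) (Fin n) 𝕜) : Prop :=
  ∃ W : ℕ → Matrix (Fin n) (Fin n) 𝕜, W 0 = M ∧ W m = T ∧
    ∀ k : Fin n, (k : ℕ) < m →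
      (∀ j, j < k → ∀ i, W (k + 1) i j = W k i j) ∧
      FlReflector ε k (fun i => W k i k) (v k) (τ k) (W (k + 1) k k) ∧
      (∀ i, i < k → W (k + 1) i k = W k i k) ∧
      (∀ i, k < i → W (k + 1) i k = 0) ∧
      (∀ j, k < j → FlApply ε k (v k) (τ k) (fun i => W k i j) (fun i => W (k + 1) i j))

/-- `Q` is the explicitly formed product `H_0 H_1 ⋯ H_{m-1}` of the computed reflectors. -/
def FlFormQ {n : ℕ} (ε : ℝ) (m : ℕ) (v : Fin n → Fin n → 𝕜) (τ : Fin n → ℝ)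
    (Q : Matrix (Fin n) (Fin n) 𝕜) : Prop :=
  ∃ P : ℕ → Matrix (Fin n) (Fin n) 𝕜, P m = 1 ∧ P 0 = Q ∧
    ∀ k : Fin n, (k : ℕ) < m → ∀ j,
      FlApply ε k (v k) (τ k) (fun i => P (k + 1) i j) (fun i => P k i j)

/-- `X` is the computed value of `(H_0 H_1 ⋯ H_{m-1})^* M`, the reflectors being applied one after
the other without forming their product. -/
def FlApplyAdjoint {n : ℕ} (ε : ℝ) (m : ℕ) (v : Fin n → Fin n → 𝕜) (τ : Fin n → ℝ)
    (M X : Matrix (Fin n) (Fin n) 𝕜) : Prop :=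
  ∃ Z : ℕ → Matrix (Fin n) (Fin n) 𝕜, Z 0 = M ∧ Z m = X ∧
    ∀ k : Fin n, (k : ℕ) < m → ∀ j,
      FlApply ε k (v k) (τ k) (fun i => Z k i j) (fun i => Z (k + 1) i j)

/-! ### Norms -/

/-- Euclidean norm of the `j`-th column. -/
def colNorm {ι κ : Type*} [Fintype ι] (M : Matrix ι κ 𝕜) (j : κ) : ℝ :=
  √(∑ i, ‖M i j‖ ^ 2)

/-- Frobenius norm. -/
def frobNorm {ι κ : Type*} [Fintype ι] [Fintype κ] (M : Matrix ι κ 𝕜) : ℝ :=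
  √(∑ i, ∑ j, ‖M i j‖ ^ 2)

open scoped Matrix.Norms.L2Operator in
/-- Spectral norm. -/
def specNorm {ι κ : Type*} [Fintype ι] [Fintype κ] [DecidableEq κ] (M : Matrix ι κ 𝕜) : ℝ :=
  ‖M‖

/-- A moderate (mildly growing) function of the dimension: nonnegative, polynomially bounded. -/
def MildlyGrowing (f : ℕ → ℝ) : Prop :=
  ∃ (c : ℝ) (d : ℕ), ∀ n : ℕ, 0 ≤ f n ∧ f n ≤ c * ((n : ℝ) + 1) ^ d

/-! ### Row partitions

An `n`-element index set is split as `r + (n - r)`, or in the other order as `(n - r) + r`. -/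

/-- `{1,…,n} = {1,…,r} ∪ {r+1,…,n}`. -/
def splitEquiv {n r : ℕ} (hr : r ≤ n) : Fin r ⊕ Fin (n - r) ≃ Fin n :=
  finSumFinEquiv.trans (finCongr (by omega))

/-- `{1,…,n} = {1,…,n-r} ∪ {n-r+1,…,n}`. -/
def stackEquiv {n r : ℕ} (hr : r ≤ n) : Fin (n - r) ⊕ Fin r ≃ Fin n :=
  finSumFinEquiv.trans (finCongr (by omega))

/-- The first `r` rows of `M`. -/
def topRows {n r : ℕ} {κ : Type*} (hr : r ≤ n) (M : Matrix (Fin n) κ 𝕜) : Matrix (Fin r) κ 𝕜 :=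
  M.submatrix (fun i => splitEquiv hr (Sum.inl i)) id

/-- The last `n - r` rows of `M`. -/
def botRows {n r : ℕ} {κ : Type*} (hr : r ≤ n) (M : Matrix (Fin n) κ 𝕜) :
    Matrix (Fin (n - r)) κ 𝕜 :=
  M.submatrix (fun i => splitEquiv hr (Sum.inr i)) id

/-- The stacked matrix with block rows `X` (`n - r` rows) and `R` (`r` rows). -/
def stack {n r : ℕ} {κ : Type*} (hr : r ≤ n) (X : Matrix (Fin (n - r)) κ 𝕜)
    (R : Matrix (Fin r) κ 𝕜) : Matrix (Fin n) κ 𝕜 :=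
  (Matrix.fromRows X R).submatrix (stackEquiv hr).symm id

/-- The first `n - r` columns of `M`. -/
def omega₁ {n r : ℕ} {ι : Type*} (hr : r ≤ n) (M : Matrix ι (Fin n) 𝕜) :
    Matrix ι (Fin (n - r)) 𝕜 :=
  M.submatrix id (fun j => stackEquiv hr (Sum.inl j))

/-- The last `r` columns of `M`. -/
def omega₂ {n r : ℕ} {ι : Type*} (hr : r ≤ n) (M : Matrix ι (Fin n) 𝕜) : Matrix ι (Fin r) 𝕜 :=
  M.submatrix id (fun j => stackEquiv hr (Sum.inr j))

/-- Keep the rows with index `< r`, replace the others by zero. -/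
def keepRows {n : ℕ} {κ : Type*} (r : ℕ) (M : Matrix (Fin n) κ 𝕜) : Matrix (Fin n) κ 𝕜 :=
  Matrix.of fun i j => if (i : ℕ) < r then M i j else 0

/-- Column permutation `M Π`: column `j` of the result is column `π j` of `M`. -/
def permCols {ι κ : Type*} (M : Matrix ι κ 𝕜) (π : Equiv.Perm κ) : Matrix ι κ 𝕜 :=
  M.submatrix id π

/-! ### The two computed deflation steps

Column interchanges are exact, so a Householder QR factorization with column pivoting is the
Householder QR factorization of the matrix `M Π` whose columns are already in pivot order. The
permutation is left arbitrary; this covers every pivoting strategy. -/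

/-- The first computed step: pivoted Householder QR factorization of `E` (`m` reflectors),
truncated at the numerical rank `r` with threshold `thr`, and the computed products
`X = computed(Q^* D)`, `Y = computed(Q^* C)`. Here `Q` is the computed numerically unitary factor
and `R` (`r × n`) the truncated triangular factor, so that `E Π ≈ Q (R ; 0)`. -/
def ComputedFirstStep {n r : ℕ} (ε thr : ℝ) (hr : r ≤ n) (C D E : Matrix (Fin n) (Fin n) 𝕜)
    (π : Equiv.Perm (Fin n)) (Q : Matrix (Fin n) (Fin n) 𝕜) (R : Matrix (Fin r) (Fin n) 𝕜)
    (X Y : Matrix (Fin n) (Fin n) 𝕜) : Prop :=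
  ∃ (m : ℕ) (v : Fin n → Fin n → 𝕜) (τ : Fin n → ℝ) (T : Matrix (Fin n) (Fin n) 𝕜),
    r ≤ m ∧ m ≤ n ∧
    FlHouseholderQR ε m (permCols E π) v τ T ∧ FlFormQ ε m v τ Q ∧
    -- numerical rank: the `r` retained pivots are nonzero, and every discarded column is below
    -- the threshold relative to every retained pivot (no pivot retained: nothing nonzero is lost)
    (∀ i : Fin n, (i : ℕ) < r → T i i ≠ 0) ∧
    (∀ i j : Fin n, (i : ℕ) < r → r ≤ (j : ℕ) → colNorm (T - keepRows r T) j ≤ thr * ‖T i i‖) ∧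
    (r = 0 → T = 0) ∧
    R = topRows hr T ∧
    (FlMatMul ε Qᴴ D X ∨ FlApplyAdjoint ε m v τ D X) ∧
    (FlMatMul ε Qᴴ C Y ∨ FlApplyAdjoint ε m v τ C Y)

/-- The matrix `(X₂ ; R Π^T)` whose rank decides about the second deflation step. -/
def secondMatrix {n r : ℕ} (hr : r ≤ n) (π : Equiv.Perm (Fin n))
    (R : Matrix (Fin r) (Fin n) 𝕜) (X : Matrix (Fin n) (Fin n) 𝕜) : Matrix (Fin n) (Fin n) 𝕜 :=
  stack hr (botRows hr X) (permCols R π.symm)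

/-- The second computed step: pivoted Householder QR factorization of `(X₂ ; R Π^T)`, with
numerical rank `r₂`, and the computed update `Q₂^* (-Y₂, -Q_{E,2}^*, 0, 0 ; 0, 0, 0, -I)`, written
`(-N₁, -N₂, N₃, N₄)`. The factor `R₂` is `n × n` with the rows below `r₂` equal to zero; what is
discarded there is, column by column, at most `thr₂` relative to the column. -/
def ComputedSecondStep {n r : ℕ} (ε thr₂ : ℝ) (hr : r ≤ n) (r₂ : ℕ) (π : Equiv.Perm (Fin n))
    (Q : Matrix (Fin n) (Fin n) 𝕜) (R : Matrix (Fin r) (Fin n) 𝕜)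
    (X Y : Matrix (Fin n) (Fin n) 𝕜)
    (π₂ : Equiv.Perm (Fin n)) (Q₂ R₂ : Matrix (Fin n) (Fin n) 𝕜)
    (N₁ N₂ N₃ : Matrix (Fin n) (Fin n) 𝕜) (N₄ : Matrix (Fin n) (Fin r) 𝕜) : Prop :=
  ∃ (m : ℕ) (v : Fin n → Fin n → 𝕜) (τ : Fin n → ℝ) (T : Matrix (Fin n) (Fin n) 𝕜),
    r₂ ≤ m ∧ m ≤ n ∧
    FlHouseholderQR ε m (permCols (secondMatrix hr π R X) π₂) v τ T ∧ FlFormQ ε m v τ Q₂ ∧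
    (∀ i : Fin n, (i : ℕ) < r₂ → T i i ≠ 0) ∧
    (∀ j, colNorm (T - keepRows r₂ T) j ≤ thr₂ * colNorm T j) ∧
    R₂ = keepRows r₂ T ∧
    FlMatMul ε (omega₁ hr Q₂ᴴ) (botRows hr Y) N₁ ∧
    FlMatMul ε (omega₁ hr Q₂ᴴ) (botRows hr Qᴴ) N₂ ∧
    N₃ = 0 ∧
    N₄ = -omega₂ hr Q₂ᴴ

/-! ### Pencils -/

/-- Index set of the `4n × 4n` linearization. -/
abbrev LinIdx (n : ℕ) : Type := (Fin n ⊕ Fin n) ⊕ (Fin n ⊕ Fin n)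

/-- Row index set of the reduced pencil: blocks of sizes `n, r, n, n`. -/
abbrev RowIdx (n r : ℕ) : Type := (Fin n ⊕ (Fin r ⊕ Fin n)) ⊕ Fin n

/-- Column index set of the reduced pencil: blocks of sizes `n, n, n, r`. -/
abbrev ColIdx (n r : ℕ) : Type := (Fin n ⊕ Fin n) ⊕ (Fin n ⊕ Fin r)

/-- The matrix `𝔸` of the linearization `𝔸 - λ 𝔹` of `λ⁴A + λ³B + λ²C + λD + E`. -/
def linA {n : ℕ} (B D E : Matrix (Fin n) (Fin n) 𝕜) : Matrix (LinIdx n) (LinIdx n) 𝕜 :=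
  fromBlocks (fromBlocks B 0 D 0) (-1) (fromBlocks 0 (-1) E 0) 0

/-- The matrix `𝔹` of the linearization `𝔸 - λ 𝔹` of `λ⁴A + λ³B + λ²C + λD + E`. -/
def linB {n : ℕ} (A C : Matrix (Fin n) (Fin n) 𝕜) : Matrix (LinIdx n) (LinIdx n) 𝕜 :=
  fromBlocks (fromBlocks (-A) 0 (-C) (-1)) 0 0 (-1)

/-- The computed matrix `P₂ 𝔸₂₂`; `S` is the `n × n` block `(R₂ Π₂^T ; 0)`. -/
def redA {n r : ℕ} (B : Matrix (Fin n) (Fin n) 𝕜) (X₁ : Matrix (Fin r) (Fin n) 𝕜)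
    (S : Matrix (Fin n) (Fin n) 𝕜) : Matrix (RowIdx n r) (ColIdx n r) 𝕜 :=
  fromBlocks
    (fromBlocks B 0 (fromRows X₁ 0) (fromRows 0 (-1)))
    (fromBlocks (-1) 0 0 (fromRows (-1) 0))
    (fromCols S 0) 0

/-- The computed matrix `P₂ 𝔹₂₂`; `U` is the stored block `Q_{E,1}^*`. -/
def redB {n r : ℕ} (A : Matrix (Fin n) (Fin n) 𝕜) (Y₁ U : Matrix (Fin r) (Fin n) 𝕜)
    (N₁ N₂ N₃ : Matrix (Fin n) (Fin n) 𝕜) (N₄ : Matrix (Fin n) (Fin r) 𝕜) :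
    Matrix (RowIdx n r) (ColIdx n r) 𝕜 :=
  fromBlocks
    (fromBlocks (-A) 0 (fromRows (-Y₁) 0) (fromRows (-U) 0))
    (fromBlocks 0 0 (fromRows 0 (-1)) 0)
    (fromCols (-N₁) (-N₂)) (fromCols N₃ N₄)

/-- The structured forward perturbation of `P₂ 𝔹₂₂`. -/
def forwardPert {n r : ℕ} (dU : Matrix (Fin r) (Fin n) 𝕜) (dN₁ dN₂ : Matrix (Fin n) (Fin n) 𝕜)
    (dN₄ : Matrix (Fin n) (Fin r) 𝕜) : Matrix (RowIdx n r) (ColIdx n r) 𝕜 :=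
  fromBlocks
    (fromBlocks 0 0 0 (fromRows (-dU) 0)) 0
    (fromCols dN₁ dN₂) (fromCols 0 dN₄)

/-- The row permutation: it lists the rows of the linearization in the order `1:n+r`, `2n+1:3n`,
`n+r+1:2n`, `3n+1:3n+r`, followed by the last `n - r` rows. -/
def rowPerm {n r : ℕ} (hr : r ≤ n) : RowIdx n r ⊕ Fin (n - r) → LinIdx n
  | Sum.inl (Sum.inl (Sum.inl i)) => Sum.inl (Sum.inl i)
  | Sum.inl (Sum.inl (Sum.inr (Sum.inl i))) => Sum.inl (Sum.inr (splitEquiv hr (Sum.inl i)))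
  | Sum.inl (Sum.inl (Sum.inr (Sum.inr i))) => Sum.inr (Sum.inl i)
  | Sum.inl (Sum.inr i) =>
      Sum.elim (fun a => Sum.inl (Sum.inr (splitEquiv hr (Sum.inr a))))
        (fun b => Sum.inr (Sum.inr (splitEquiv hr (Sum.inl b)))) ((stackEquiv hr).symm i)
  | Sum.inr i => Sum.inr (Sum.inr (splitEquiv hr (Sum.inr i)))

/-- The columns of the linearization in their original order, partitioned as `(3n+r) + (n-r)`. -/
def colPart {n r : ℕ} (hr : r ≤ n) : ColIdx n r ⊕ Fin (n - r) → LinIdx n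
  | Sum.inl (Sum.inl i) => Sum.inl i
  | Sum.inl (Sum.inr (Sum.inl i)) => Sum.inr (Sum.inl i)
  | Sum.inl (Sum.inr (Sum.inr i)) => Sum.inr (Sum.inr (splitEquiv hr (Sum.inl i)))
  | Sum.inr i => Sum.inr (Sum.inr (splitEquiv hr (Sum.inr i)))

theorem rowPerm_bijective {n r : ℕ} (hr : r ≤ n) : Function.Bijective (rowPerm hr) := by
  rw [Fintype.bijective_iff_surjective_and_card]
  constructor
  · rintro ((i | i) | (i | i))
    · exact ⟨Sum.inl (Sum.inl (Sum.inl i)), rfl⟩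
    · obtain ⟨x, rfl⟩ := (splitEquiv hr).surjective i
      rcases x with a | b
      · exact ⟨Sum.inl (Sum.inl (Sum.inr (Sum.inl a))), rfl⟩
      · exact ⟨Sum.inl (Sum.inr (stackEquiv hr (Sum.inl b))), by simp [rowPerm]⟩
    · exact ⟨Sum.inl (Sum.inl (Sum.inr (Sum.inr i))), rfl⟩
    · obtain ⟨x, rfl⟩ := (splitEquiv hr).surjective i
      rcases x with a | b
      · exact ⟨Sum.inl (Sum.inr (stackEquiv hr (Sum.inr a))), by simp [rowPerm]⟩
      · exact ⟨Sum.inr b, rfl⟩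
  · simp only [Fintype.card_sum, Fintype.card_fin]
    omega

theorem colPart_bijective {n r : ℕ} (hr : r ≤ n) : Function.Bijective (colPart hr) := by
  rw [Fintype.bijective_iff_surjective_and_card]
  constructor
  · rintro (i | (i | i))
    · exact ⟨Sum.inl (Sum.inl i), rfl⟩
    · exact ⟨Sum.inl (Sum.inr (Sum.inl i)), rfl⟩
    · obtain ⟨x, rfl⟩ := (splitEquiv hr).surjective i
      rcases x with a | b
      · exact ⟨Sum.inl (Sum.inr (Sum.inr a)), rfl⟩
      · exact ⟨Sum.inr b, rfl⟩
  · simp only [Fintype.card_sum, Fintype.card_fin]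
    omega

/-- The equivalence transformation of the two deflation steps with the (exactly unitary) matrices
`QE`, `Q₂`, applied to a `4n × 4n` matrix `M`:
`(I ⊕ Q₂^* ⊕ I) · permutation · (I ⊕ QE^* ⊕ I ⊕ QE^*) · M · (I ⊕ I ⊕ I ⊕ QE)`. -/
def deflationTransform {n r : ℕ} (hr : r ≤ n) (QE Q₂ : Matrix (Fin n) (Fin n) 𝕜)
    (M : Matrix (LinIdx n) (LinIdx n) 𝕜) :
    Matrix (RowIdx n r ⊕ Fin (n - r)) (ColIdx n r ⊕ Fin (n - r)) 𝕜 :=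
  (fromBlocks (fromBlocks 1 0 0 Q₂ᴴ) 0 0 1 :
      Matrix (RowIdx n r ⊕ Fin (n - r)) (RowIdx n r ⊕ Fin (n - r)) 𝕜) *
    ((fromBlocks (fromBlocks 1 0 0 QEᴴ) 0 0 (fromBlocks 1 0 0 QEᴴ) :
        Matrix (LinIdx n) (LinIdx n) 𝕜) * M *
      (fromBlocks 1 0 0 (fromBlocks 1 0 0 QE) : Matrix (LinIdx n) (LinIdx n) 𝕜)).submatrix
        (rowPerm hr) (colPart hr)

end QuarticDeflation

end

noncomputable section

namespace QuarticDeflation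

open Matrix

/-! ### Euclidean and Frobenius norms -/

/-! Every computed transformation is compared with one exactly unitary matrix: the product
`houseProd` of the exact reflectors `house v` built from the computed Householder vectors. An exact
reflector is unitary whatever vector defines it, so nothing needs to be known about `v` beyond two
facts. The computed scalar is close to `2 / ‖v‖²`, and the exact reflector nearly annihilates the
pivot column (`FlReflector.near`). Applying a computed reflector then differs from applying the
exact one by a small relative error (`FlApply.l2norm_sub_le`). Unitary matrices do not amplify
errors, so a whole sequence costs only a factor `(1 + 100 η) ^ n - 1`, column by column
(`FlHouseholderQR.near`, `FlFormQ.colNorm_sub_le`, `FlApplyAdjoint.colNorm_sub_le`).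

With these unitary matrices, the errors of the first step become backward errors in `C`, `D`, `E`
(`ErrorLevels.exists_backward_errors`, `ErrorLevels.exists_truncated_qr`). The residual of the
second factorization, including what is discarded, is split into `Γ₁` and `Γ₂`. These are carried
back to `D` and `E` through complementary blocks of the first unitary matrix, whose orthogonality
ensures that `Γ₁` alters only the trailing rows of the transformed `D` and `Γ₂` only the leading
rows of the transformed `E`.

The remaining errors sit in `𝔹`: in the stored unitary blocks and in the products `N₁`, `N₂`. They
are kept as forward errors. They are small relative to the computed blocks because `N₁` is nearly an
isometric image of its right factor and `N₂` has norm at least `1/2` when it is not trivial. The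
block identities for the exact transformation are `deflationTransform_linA` and
`deflationTransform_linB`; `ErrorLevels.mixed_stable_deflation` puts everything together. -/

/-- Euclidean norm of a coordinate vector. -/
def l2norm {𝕜 : Type*} [RCLike 𝕜] {ι : Type*} [Fintype ι] (x : ι → 𝕜) : ℝ :=
  √(∑ i, ‖x i‖ ^ 2)

section Norms

variable {𝕜 : Type*} [RCLike 𝕜] {ι κ μ : Type*} [Fintype ι]

theorem l2norm_eq_norm (x : ι → 𝕜) : l2norm x = ‖WithLp.toLp 2 x‖ :=
  (EuclideanSpace.norm_eq _).symm

theorem l2norm_nonneg (x : ι → 𝕜) : 0 ≤ l2norm x := Real.sqrt_nonneg _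

theorem l2norm_sq (x : ι → 𝕜) : l2norm x ^ 2 = ∑ i, ‖x i‖ ^ 2 :=
  Real.sq_sqrt (by positivity)

theorem l2norm_zero : l2norm (0 : ι → 𝕜) = 0 := by simp [l2norm]

theorem l2norm_add_le (x y : ι → 𝕜) : l2norm (x + y) ≤ l2norm x + l2norm y := by
  simp only [l2norm_eq_norm, WithLp.toLp_add]
  exact norm_add_le _ _

theorem l2norm_neg (x : ι → 𝕜) : l2norm (-x) = l2norm x := by simp [l2norm]

theorem l2norm_sub_rev (x y : ι → 𝕜) : l2norm (x - y) = l2norm (y - x) := by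
  rw [← l2norm_neg, neg_sub]

theorem l2norm_sub_le_sub_add_sub (x y z : ι → 𝕜) :
    l2norm (x - z) ≤ l2norm (x - y) + l2norm (y - z) := by
  simpa using l2norm_add_le (x - y) (y - z)

theorem l2norm_le_add_sub (x y : ι → 𝕜) : l2norm x ≤ l2norm y + l2norm (x - y) := by
  simpa using l2norm_add_le y (x - y)

theorem l2norm_smul (c : 𝕜) (x : ι → 𝕜) : l2norm (c • x) = ‖c‖ * l2norm x := by
  simp only [l2norm_eq_norm, WithLp.toLp_smul, norm_smul]

theorem l2norm_mono {𝕜' : Type*} [RCLike 𝕜'] {x : ι → 𝕜} {y : ι → 𝕜'}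
    (h : ∀ i, ‖x i‖ ≤ ‖y i‖) : l2norm x ≤ l2norm y :=
  Real.sqrt_le_sqrt (Finset.sum_le_sum fun i _ => pow_le_pow_left₀ (norm_nonneg _) (h i) 2)

theorem norm_apply_le_l2norm (x : ι → 𝕜) (i : ι) : ‖x i‖ ≤ l2norm x :=
  Real.le_sqrt_of_sq_le
    (Finset.single_le_sum (f := fun i => ‖x i‖ ^ 2) (fun _ _ => by positivity) (Finset.mem_univ i))

theorem sum_norm_mul_le (x y : ι → 𝕜) : ∑ i, ‖x i‖ * ‖y i‖ ≤ l2norm x * l2norm y :=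
  Real.sum_mul_le_sqrt_mul_sqrt _ _ _

theorem norm_dotProduct_le (x y : ι → 𝕜) : ‖x ⬝ᵥ y‖ ≤ l2norm x * l2norm y :=
  (norm_sum_le _ _).trans ((Finset.sum_le_sum fun _ _ => (norm_mul _ _).le).trans
    (sum_norm_mul_le x y))

theorem l2norm_star (x : ι → 𝕜) : l2norm (star x) = l2norm x := by simp [l2norm]

theorem star_dotProduct_self (x : ι → 𝕜) : star x ⬝ᵥ x = ((l2norm x ^ 2 : ℝ) : 𝕜) := by
  rw [l2norm_sq, dotProduct]
  push_cast
  exact Finset.sum_congr rfl fun i _ => by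
    simp only [Pi.star_apply, RCLike.star_def, RCLike.conj_mul]

theorem colNorm_eq (M : Matrix ι κ 𝕜) (j : κ) : colNorm M j = l2norm (fun i => M i j) := rfl

theorem colNorm_nonneg (M : Matrix ι κ 𝕜) (j : κ) : 0 ≤ colNorm M j := Real.sqrt_nonneg _

theorem colNorm_le_add_sub (M N : Matrix ι κ 𝕜) (j : κ) :
    colNorm M j ≤ colNorm N j + colNorm (M - N) j :=
  l2norm_le_add_sub (fun i => M i j) (fun i => N i j)

theorem colNorm_add_le (M N : Matrix ι κ 𝕜) (j : κ) :
    colNorm (M + N) j ≤ colNorm M j + colNorm N j :=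
  l2norm_add_le (fun i => M i j) (fun i => N i j)

theorem colNorm_neg (M : Matrix ι κ 𝕜) (j : κ) : colNorm (-M) j = colNorm M j :=
  l2norm_neg (fun i => M i j)

theorem colNorm_sub_rev (M N : Matrix ι κ 𝕜) (j : κ) : colNorm (M - N) j = colNorm (N - M) j := by
  rw [← colNorm_neg, neg_sub]

theorem colNorm_submatrix_le {ι' : Type*} [Fintype ι'] (M : Matrix ι κ 𝕜)
    {e : ι' → ι} (he : Function.Injective e) (j : κ) :
    colNorm (M.submatrix e id) j ≤ colNorm M j := by
  classical
  refine Real.sqrt_le_sqrt ?_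
  calc ∑ p : ι', ‖M.submatrix e id p j‖ ^ 2
      = ∑ p ∈ (Finset.univ : Finset ι').map ⟨_, he⟩, ‖M p j‖ ^ 2 := by
        rw [Finset.sum_map]; rfl
    _ ≤ _ := Finset.sum_le_sum_of_subset_of_nonneg (Finset.subset_univ _)
        fun _ _ _ => by positivity

variable [Fintype κ]

theorem l2norm_mulVec_of_isometry [DecidableEq κ] {M : Matrix ι κ 𝕜} (hM : Mᴴ * M = 1)
    (x : κ → 𝕜) : l2norm (M *ᵥ x) = l2norm x := by
  have h : ((l2norm (M *ᵥ x) ^ 2 : ℝ) : 𝕜) = ((l2norm x ^ 2 : ℝ) : 𝕜) := by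
    rw [← star_dotProduct_self, ← star_dotProduct_self, star_mulVec, dotProduct_mulVec,
      vecMul_vecMul, hM, vecMul_one]
  exact (sq_eq_sq₀ (l2norm_nonneg _) (l2norm_nonneg _)).1 (RCLike.ofReal_injective h)

theorem colNorm_mul_of_isometry [DecidableEq κ] {M : Matrix ι κ 𝕜} (hM : Mᴴ * M = 1)
    (N : Matrix κ μ 𝕜) (j : μ) : colNorm (M * N) j = colNorm N j :=
  l2norm_mulVec_of_isometry hM (fun i => N i j)

theorem frobNorm_nonneg (M : Matrix ι κ 𝕜) : 0 ≤ frobNorm M := Real.sqrt_nonneg _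

theorem frobNorm_eq_l2norm (M : Matrix ι κ 𝕜) :
    frobNorm M = l2norm (fun p : ι × κ => M p.1 p.2) := by
  rw [frobNorm, l2norm, Fintype.sum_prod_type]

theorem frobNorm_add_le (M N : Matrix ι κ 𝕜) : frobNorm (M + N) ≤ frobNorm M + frobNorm N := by
  simp only [frobNorm_eq_l2norm]
  exact l2norm_add_le _ _

theorem frobNorm_neg (M : Matrix ι κ 𝕜) : frobNorm (-M) = frobNorm M := by simp [frobNorm]

theorem frobNorm_conjTranspose (M : Matrix ι κ 𝕜) : frobNorm Mᴴ = frobNorm M := by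
  rw [frobNorm, frobNorm, Finset.sum_comm]
  simp

theorem frobNorm_sq_eq_sum_colNorm (M : Matrix ι κ 𝕜) :
    frobNorm M ^ 2 = ∑ j, colNorm M j ^ 2 := by
  rw [frobNorm, Real.sq_sqrt (by positivity), Finset.sum_comm]
  exact Finset.sum_congr rfl fun j _ => (Real.sq_sqrt (by positivity)).symm

theorem frobNorm_le_of_colNorm_le [Fintype μ] {M : Matrix ι κ 𝕜} {N : Matrix μ κ 𝕜} {c : ℝ} (hc : 0 ≤ c)
    (h : ∀ j, colNorm M j ≤ c * colNorm N j) : frobNorm M ≤ c * frobNorm N := by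
  refine abs_le_of_sq_le_sq' ?_ (mul_nonneg hc (frobNorm_nonneg _)) |>.2
  rw [mul_pow, frobNorm_sq_eq_sum_colNorm, frobNorm_sq_eq_sum_colNorm, Finset.mul_sum]
  exact Finset.sum_le_sum fun j _ => by
    rw [← mul_pow]
    exact pow_le_pow_left₀ (colNorm_nonneg _ _) (h j) 2

theorem l2norm_mulVec_le (M : Matrix ι κ 𝕜) (x : κ → 𝕜) :
    l2norm (M *ᵥ x) ≤ frobNorm M * l2norm x := by
  refine abs_le_of_sq_le_sq' ?_ (mul_nonneg (frobNorm_nonneg _) (l2norm_nonneg _)) |>.2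
  rw [mul_pow, l2norm_sq, frobNorm, Real.sq_sqrt (by positivity), Finset.sum_mul]
  refine Finset.sum_le_sum fun i _ => ?_
  have h := norm_dotProduct_le (M i) x
  calc ‖(M *ᵥ x) i‖ ^ 2 ≤ (l2norm (M i) * l2norm x) ^ 2 := pow_le_pow_left₀ (norm_nonneg _) h 2
    _ = _ := by rw [mul_pow, l2norm_sq (M i)]

theorem colNorm_mul_le (M : Matrix ι κ 𝕜) (N : Matrix κ μ 𝕜) (j : μ) :
    colNorm (M * N) j ≤ frobNorm M * colNorm N j :=
  l2norm_mulVec_le M (fun i => N i j)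

theorem frobNorm_mul_of_isometry [Fintype μ] [DecidableEq κ] {M : Matrix ι κ 𝕜} (hM : Mᴴ * M = 1)
    (N : Matrix κ μ 𝕜) : frobNorm (M * N) = frobNorm N := by
  rw [← sq_eq_sq₀ (frobNorm_nonneg _) (frobNorm_nonneg _), frobNorm_sq_eq_sum_colNorm,
    frobNorm_sq_eq_sum_colNorm]
  simp only [colNorm_mul_of_isometry hM]

theorem frobNorm_one [DecidableEq κ] : frobNorm (1 : Matrix κ κ 𝕜) = √(Fintype.card κ) := by
  rw [frobNorm]
  congr 1
  have h : ∀ i : κ, ∑ j, ‖(1 : Matrix κ κ 𝕜) i j‖ ^ 2 = 1 := fun i => by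
    rw [Finset.sum_eq_single i]
    · simp
    · intro b _ hb
      simp [Matrix.one_apply_ne hb.symm]
    · simp
  simp [h]

theorem frobNorm_submatrix_le {ι' κ' : Type*} [Fintype ι'] [Fintype κ'] (M : Matrix ι κ 𝕜)
    {e : ι' → ι} (he : Function.Injective e) {f : κ' → κ} (hf : Function.Injective f) :
    frobNorm (M.submatrix e f) ≤ frobNorm M := by
  classical
  rw [frobNorm_eq_l2norm, frobNorm_eq_l2norm]
  refine Real.sqrt_le_sqrt ?_
  have hinj : Function.Injective (Prod.map e f) := he.prodMap hf
  calc ∑ p : ι' × κ', ‖M.submatrix e f p.1 p.2‖ ^ 2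
      = ∑ p ∈ (Finset.univ : Finset (ι' × κ')).map ⟨_, hinj⟩, ‖M p.1 p.2‖ ^ 2 := by
        rw [Finset.sum_map]; rfl
    _ ≤ _ := Finset.sum_le_sum_of_subset_of_nonneg (Finset.subset_univ _)
        fun _ _ _ => by positivity

open scoped Matrix.Norms.L2Operator in
theorem l2norm_mulVec_le_specNorm [DecidableEq κ] (M : Matrix ι κ 𝕜) (x : κ → 𝕜) :
    l2norm (M *ᵥ x) ≤ specNorm M * l2norm x := by
  rw [l2norm_eq_norm, l2norm_eq_norm]
  exact Matrix.l2_opNorm_mulVec M (WithLp.toLp 2 x)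

open scoped Matrix.Norms.L2Operator in
theorem specNorm_nonneg [DecidableEq κ] (M : Matrix ι κ 𝕜) : 0 ≤ specNorm M := by
  rw [specNorm]
  exact norm_nonneg M

open scoped Matrix.Norms.L2Operator in
theorem specNorm_le_frobNorm [DecidableEq κ] (M : Matrix ι κ 𝕜) : specNorm M ≤ frobNorm M := by
  rw [specNorm, Matrix.l2_opNorm_def]
  refine ContinuousLinearMap.opNorm_le_bound _ (frobNorm_nonneg _) fun x => ?_
  have h := l2norm_mulVec_le M x.ofLp
  rw [l2norm_eq_norm, l2norm_eq_norm] at h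
  exact h

end Norms

/-! ### Rounding errors of sums and products -/

section Rounding

variable {𝕜 : Type*} [RCLike 𝕜] {ι : Type*} {ε : ℝ}

theorem Rnd.norm_sub_le {x y : 𝕜} (h : Rnd ε x y) : ‖y - x‖ ≤ ε * ‖x‖ := by
  obtain ⟨δ, hδ, rfl⟩ := h
  rw [show x * (1 + δ) - x = δ * x by ring, norm_mul]
  gcongr

theorem FlTree.card_pos {s : Multiset 𝕜} {c : 𝕜} (h : FlTree ε s c) : 1 ≤ s.card := by
  induction h with
  | single a => simp
  | add s t a b c _ _ _ h₁ h₂ => rw [Multiset.card_add]; omega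

/-- Independent of the summation order: both subtrees of an addition are nonempty, so the
cardinality grows by at least one on each side and pays for the factor `1 + ε` of that addition. -/
theorem FlTree.norm_sub_sum_le (hε : 0 ≤ ε) {s : Multiset 𝕜} {c : 𝕜} (h : FlTree ε s c) :
    ‖c - s.sum‖ ≤ ((1 + ε) ^ s.card - 1) * (s.map norm).sum := by
  induction h with
  | single a => simpa using mul_nonneg hε (norm_nonneg a)
  | add s t a b c hs ht hc h₁ h₂ =>
    have hp := hs.card_pos
    have hq := ht.card_pos
    have hc := hc.norm_sub_le
    rw [Multiset.card_add, Multiset.sum_add, Multiset.map_add, Multiset.sum_add]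
    set p := s.card
    set q := t.card
    set σ := (s.map norm).sum
    set σ' := (t.map norm).sum
    have hσ : ‖s.sum‖ ≤ σ := norm_multiset_sum_le s
    have hσ' : ‖t.sum‖ ≤ σ' := norm_multiset_sum_le t
    have hσ0 : 0 ≤ σ := (norm_nonneg _).trans hσ
    have hσ0' : 0 ≤ σ' := (norm_nonneg _).trans hσ'
    have ha : ‖a‖ ≤ (1 + ε) ^ p * σ := by
      have := norm_le_norm_add_norm_sub' a s.sum
      linarith
    have hb : ‖b‖ ≤ (1 + ε) ^ q * σ' := by
      have := norm_le_norm_add_norm_sub' b t.sum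
      linarith
    have h1 : (1 + ε) ^ p * (1 + ε) ≤ (1 + ε) ^ (p + q) := by
      rw [← pow_succ]
      exact pow_le_pow_right₀ (by linarith) (by omega)
    have h2 : (1 + ε) ^ q * (1 + ε) ≤ (1 + ε) ^ (p + q) := by
      rw [← pow_succ]
      exact pow_le_pow_right₀ (by linarith) (by omega)
    have h3 : ‖c - (s.sum + t.sum)‖ ≤ ε * (‖a‖ + ‖b‖) + (‖a - s.sum‖ + ‖b - t.sum‖) := by
      calc ‖c - (s.sum + t.sum)‖ = ‖(c - (a + b)) + ((a - s.sum) + (b - t.sum))‖ := by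
            congr 1; ring
        _ ≤ ‖c - (a + b)‖ + ‖(a - s.sum) + (b - t.sum)‖ := norm_add_le _ _
        _ ≤ _ := add_le_add (hc.trans (by gcongr; exact norm_add_le _ _)) (norm_add_le _ _)
    have h4 := mul_le_mul_of_nonneg_right h1 hσ0
    have h5 := mul_le_mul_of_nonneg_right h2 hσ0'
    have h6 := mul_le_mul_of_nonneg_left ha hε
    have h7 := mul_le_mul_of_nonneg_left hb hε
    nlinarith

theorem FlSum.norm_sub_sum_le (hε : 0 ≤ ε) {s : Multiset 𝕜} {c : 𝕜} (h : FlSum ε s c) :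
    ‖c - s.sum‖ ≤ ((1 + ε) ^ s.card - 1) * (s.map norm).sum := by
  rcases h with ⟨rfl, rfl⟩ | h
  · simp
  · exact h.norm_sub_sum_le hε

/-- The exponent `S.card + 1` counts the summation and one further rounding, that of the individual
terms. Inner products and squared norms are both instances. -/
theorem norm_sub_sum_le_of_rounded_terms (hε : 0 ≤ ε) (S : Finset ι) {q p : ι → 𝕜} {w : 𝕜}
    (hp : ∀ i ∈ S, Rnd ε (q i) (p i)) (hw : FlSum ε (S.val.map p) w) :
    ‖w - ∑ i ∈ S, q i‖ ≤ ((1 + ε) ^ (S.card + 1) - 1) * ∑ i ∈ S, ‖q i‖ := by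
  have h := hw.norm_sub_sum_le hε
  rw [Multiset.card_map, Multiset.map_map] at h
  change ‖w - ∑ i ∈ S, p i‖ ≤ ((1 + ε) ^ S.card - 1) * ∑ i ∈ S, ‖p i‖ at h
  have h1 : ‖∑ i ∈ S, p i - ∑ i ∈ S, q i‖ ≤ ε * ∑ i ∈ S, ‖q i‖ := by
    rw [← Finset.sum_sub_distrib, Finset.mul_sum]
    exact (norm_sum_le _ _).trans (Finset.sum_le_sum fun i hi => (hp i hi).norm_sub_le)
  have h2 : ∑ i ∈ S, ‖p i‖ ≤ (1 + ε) * ∑ i ∈ S, ‖q i‖ := by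
    rw [Finset.mul_sum]
    refine Finset.sum_le_sum fun i hi => ?_
    have := norm_le_norm_add_norm_sub' (p i) (q i)
    have := (hp i hi).norm_sub_le
    linarith
  have h3 : 0 ≤ (1 + ε) ^ S.card - 1 := sub_nonneg.2 (one_le_pow₀ (by linarith))
  have h4 := mul_le_mul_of_nonneg_left h2 h3
  have h5 := norm_sub_le_norm_sub_add_norm_sub w (∑ i ∈ S, p i) (∑ i ∈ S, q i)
  rw [pow_succ]
  linarith

theorem FlDot.norm_sub_le (hε : 0 ≤ ε) {S : Finset ι} {x y : ι → 𝕜} {w : 𝕜}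
    (h : FlDot ε S x y w) {n : ℕ} (hn : S.card ≤ n) {η : ℝ} (hη : (1 + ε) ^ (n + 1) ≤ 1 + η) :
    ‖w - ∑ i ∈ S, x i * y i‖ ≤ η * ∑ i ∈ S, ‖x i‖ * ‖y i‖ := by
  obtain ⟨p, hp, hw⟩ := h
  refine (norm_sub_sum_le_of_rounded_terms hε S hp hw).trans ?_
  simp only [norm_mul]
  gcongr
  have := pow_le_pow_right₀ (show (1 : ℝ) ≤ 1 + ε by linarith) (Nat.succ_le_succ hn)
  simp only [Nat.succ_eq_add_one] at this
  linarith

theorem FlNormSq.abs_sub_le (hε : 0 ≤ ε) {S : Finset ι} {x : ι → 𝕜} {σ : ℝ}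
    (h : FlNormSq ε S x σ) {n : ℕ} (hn : S.card ≤ n) {η : ℝ} (hη : (1 + ε) ^ (n + 1) ≤ 1 + η) :
    |σ - ∑ i ∈ S, ‖x i‖ ^ 2| ≤ η * ∑ i ∈ S, ‖x i‖ ^ 2 := by
  obtain ⟨p, hp, hw⟩ := h
  refine (norm_sub_sum_le_of_rounded_terms hε S hp hw).trans ?_
  simp only [norm_pow, norm_norm]
  gcongr
  have := pow_le_pow_right₀ (show (1 : ℝ) ≤ 1 + ε by linarith) (Nat.succ_le_succ hn)
  simp only [Nat.succ_eq_add_one] at this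
  linarith

theorem FlMatMul.colNorm_sub_le {κ μ : Type*} [Fintype ι] [Fintype κ] (hε : 0 ≤ ε)
    {X : Matrix ι κ 𝕜} {Y : Matrix κ μ 𝕜} {Z : Matrix ι μ 𝕜} (h : FlMatMul ε X Y Z)
    {n : ℕ} (hn : Fintype.card κ ≤ n) {η : ℝ} (hη0 : 0 ≤ η) (hη : (1 + ε) ^ (n + 1) ≤ 1 + η)
    (j : μ) : colNorm (Z - X * Y) j ≤ η * frobNorm X * colNorm Y j := by
  have h1 : ∀ i, ‖Z i j - (X * Y) i j‖ ≤ ‖η * colNorm Y j * l2norm (X i)‖ := fun i => by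
    have h2 := (h i j).norm_sub_le hε (by simpa using hn) hη
    have h3 := mul_le_mul_of_nonneg_left (sum_norm_mul_le (X i) (fun k => Y k j)) hη0
    rw [← colNorm_eq] at h3
    rw [Matrix.mul_apply]
    refine (h2.trans h3).trans ((le_of_eq ?_).trans (le_abs_self _))
    ring
  calc colNorm (Z - X * Y) j ≤ l2norm (fun i => η * colNorm Y j * l2norm (X i)) :=
        l2norm_mono h1
    _ = ‖η * colNorm Y j‖ * l2norm (fun i => l2norm (X i)) :=
        l2norm_smul (η * colNorm Y j) (fun i => l2norm (X i))
    _ = η * frobNorm X * colNorm Y j := by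
        have h4 : l2norm (fun i => l2norm (X i)) = frobNorm X := by
          rw [l2norm, frobNorm]
          simp only [Real.norm_eq_abs, sq_abs, l2norm_sq]
        rw [h4, Real.norm_of_nonneg (mul_nonneg hη0 (colNorm_nonneg _ _))]
        ring

/-- Compare with the exponential: `(1 + x) ^ m ≤ exp y` for `y = m x`, and `exp y ≤ 1 + y + y² ≤ 1 +
2 y` on `[0, 1]`. -/
theorem one_add_pow_le_one_add_two_mul {x : ℝ} (hx : 0 ≤ x) (m : ℕ) (hmx : m * x ≤ 1) :
    (1 + x) ^ m ≤ 1 + 2 * (m * x) := by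
  have h0 : 0 ≤ m * x := by positivity
  have h1 : (1 + x) ^ m ≤ Real.exp (m * x) := by
    rw [Real.exp_nat_mul]
    exact pow_le_pow_left₀ (by linarith) (by linarith [Real.add_one_le_exp x]) m
  have h2 := Real.abs_exp_sub_one_sub_id_le (x := m * x) (by rwa [abs_of_nonneg h0])
  have h3 := (abs_le.1 h2).2
  nlinarith

end Rounding

/-! ### One Householder reflection -/

section Reflector

variable {𝕜 : Type*} [RCLike 𝕜] {n : ℕ} {ε η : ℝ}

theorem l2norm_norm {ι : Type*} [Fintype ι] (x : ι → 𝕜) : l2norm (fun i => ‖x i‖) = l2norm x := by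
  simp [l2norm]

/-- The exact Householder reflector `I - 2 v v^* / ‖v‖²` (the identity if `v = 0`). -/
def house (v : Fin n → 𝕜) : Matrix (Fin n) (Fin n) 𝕜 :=
  1 - ((2 / l2norm v ^ 2 : ℝ) : 𝕜) • vecMulVec v (star v)

theorem house_conjTranspose (v : Fin n → 𝕜) : (house v)ᴴ = house v := by
  rw [house, conjTranspose_sub, conjTranspose_one, conjTranspose_smul, conjTranspose_vecMulVec,
    star_star, RCLike.star_def, RCLike.conj_ofReal]

theorem house_mul_self (v : Fin n → 𝕜) : house v * house v = 1 := by
  have h : vecMulVec v (star v) * vecMulVec v (star v) =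
      ((l2norm v ^ 2 : ℝ) : 𝕜) • vecMulVec v (star v) := by
    rw [vecMulVec_mul_vecMulVec, star_dotProduct_self]
    ext i j
    simp [vecMulVec_apply]
    ring
  have hc : (2 / l2norm v ^ 2) * (2 / l2norm v ^ 2) * l2norm v ^ 2 =
      2 * (2 / l2norm v ^ 2) := by
    by_cases h0 : l2norm v = 0
    · simp [h0]
    · field_simp
  have hc' := congrArg (fun x : ℝ => (x : 𝕜)) hc
  push_cast at hc'
  rw [house, sub_mul, mul_sub, mul_sub, smul_mul_smul_comm, h, smul_smul, one_mul, mul_one, one_mul]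
  push_cast
  rw [hc', mul_smul, ofNat_smul_eq_nsmul, two_nsmul]
  abel

theorem house_mem_unitaryGroup (v : Fin n → 𝕜) : house v ∈ unitaryGroup (Fin n) 𝕜 := by
  rw [mem_unitaryGroup_iff, star_eq_conjTranspose, house_conjTranspose, house_mul_self]

theorem house_mulVec_apply (v b : Fin n → 𝕜) (i : Fin n) :
    (house v *ᵥ b) i = b i - v i * (((2 / l2norm v ^ 2 : ℝ) : 𝕜) * (star v ⬝ᵥ b)) := by
  rw [house, sub_mulVec, one_mulVec, smul_mulVec, vecMulVec_mulVec]
  simp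
  ring

/-- The computed reflector `I - τ v v^*` acts on the coordinates `≥ k` and `τ` is close to
`2 / ‖v‖²`. -/
def IsNearReflector (η : ℝ) (k : Fin n) (v : Fin n → 𝕜) (τ : ℝ) : Prop :=
  (∀ i, i < k → v i = 0) ∧ ∃ θ : ℝ, |θ| ≤ 3 * η ∧ τ = 2 / l2norm v ^ 2 * (1 + θ)

theorem sum_Ici_of_support {M : Type*} [AddCommMonoid M] {k : Fin n} {f : Fin n → M}
    (h : ∀ i, i < k → f i = 0) : ∑ i ∈ Finset.Ici k, f i = ∑ i, f i :=
  Finset.sum_subset (Finset.subset_univ _) fun i _ hi => h i (by simpa using hi)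

theorem card_Ici_le (k : Fin n) : (Finset.Ici k).card ≤ n := by
  simp

/-- The correction `v (c v^* b)` has norm at most `c ‖v‖² ‖b‖ ≤ 2 ‖b‖`, so relative errors of order
`η` in its ingredients stay of order `η ‖b‖`, whatever the size of `v`. The numerical constants are
generous. -/
theorem FlApply.l2norm_sub_le (hε : 0 ≤ ε) (hεη : ε ≤ η) (hη : (1 + ε) ^ (n + 1) ≤ 1 + η)
    (hη1 : η ≤ 1 / 100) {k : Fin n} {v : Fin n → 𝕜} {τ : ℝ} (hv : IsNearReflector η k v τ)
    {b y : Fin n → 𝕜} (h : FlApply ε k v τ b y) :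
    l2norm (y - house v *ᵥ b) ≤ 100 * η * l2norm b := by
  obtain ⟨hv0, θ, hθ, rfl⟩ := hv
  obtain ⟨w, t, p, hw, ht, hp, hy⟩ := h
  have hη0 : 0 ≤ η := hε.trans hεη
  set V := l2norm v with hV
  set β := l2norm b with hβ
  have hV0 : 0 ≤ V := l2norm_nonneg v
  have hβ0 : 0 ≤ β := l2norm_nonneg b
  set c : ℝ := 2 / V ^ 2 with hc
  have hc0 : 0 ≤ c := by positivity
  have hcV : c * V * V ≤ 2 := by
    by_cases h0 : V = 0
    · simp [h0]
    · rw [hc]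
      field_simp
      rfl
  set d := star v ⬝ᵥ b with hd
  have hdle : ‖d‖ ≤ V * β := by
    have := norm_dotProduct_le (star v) b
    rwa [l2norm_star] at this
  have hwd : ‖w - d‖ ≤ η * (V * β) := by
    have h1 := hw.norm_sub_le hε (card_Ici_le k) hη
    -- The computed inner product runs over the indices `≥ k` only; the support of `v` makes it an
    -- approximation of the full one.
    rw [sum_Ici_of_support (fun i hi => by simp [hv0 i hi]),
      sum_Ici_of_support (fun i hi => by simp [hv0 i hi])] at h1
    refine h1.trans ?_
    gcongr
    simpa only [norm_star] using sum_norm_mul_le v b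
  have hVβ : 0 ≤ V * β := by positivity
  have hwle : ‖w‖ ≤ 101 / 100 * (V * β) := by
    have := norm_le_norm_add_norm_sub' w d
    nlinarith
  set G := c * (V * β) with hG
  have hG0 : 0 ≤ G := by positivity
  have hcw : c * ‖w‖ ≤ 101 / 100 * G := by
    have := mul_le_mul_of_nonneg_left hwle hc0
    linarith
  have hcwd : c * ‖w - d‖ ≤ η * G := by
    have := mul_le_mul_of_nonneg_left hwd hc0
    linarith
  have hcd : c * ‖d‖ ≤ G := mul_le_mul_of_nonneg_left hdle hc0
  set t0 : 𝕜 := (c : 𝕜) * d with ht0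
  have ht0le : ‖t0‖ ≤ G := by
    rw [ht0, norm_mul, RCLike.norm_of_nonneg hc0]
    exact hcd
  set u : 𝕜 := ((c * (1 + θ) : ℝ) : 𝕜) * w with hu
  have hcwnn : 0 ≤ c * ‖w‖ := by positivity
  have hut : ‖u - t0‖ ≤ 5 * η * G := by
    have h1 : u - t0 = (c : 𝕜) * (w - d) + (θ : 𝕜) * ((c : 𝕜) * w) := by
      rw [hu, ht0]; push_cast; ring
    rw [h1]
    refine (norm_add_le _ _).trans ?_
    rw [norm_mul, norm_mul, norm_mul, RCLike.norm_of_nonneg hc0, RCLike.norm_ofReal]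
    have : |θ| * (c * ‖w‖) ≤ 3 * η * (101 / 100 * G) :=
      mul_le_mul hθ hcw hcwnn (by positivity)
    nlinarith [mul_nonneg hη0 hG0]
  have hηG : 0 ≤ η * G := mul_nonneg hη0 hG0
  have hηG1 : η * G ≤ 1 / 100 * G := mul_le_mul_of_nonneg_right hη1 hG0
  have hule : ‖u‖ ≤ 105 / 100 * G := by
    have := norm_le_norm_add_norm_sub' u t0
    linarith
  have htu : ‖t - u‖ ≤ 2 * η * G := by
    refine ht.norm_sub_le.trans ?_
    have : ε * ‖u‖ ≤ η * (105 / 100 * G) := mul_le_mul hεη hule (norm_nonneg _) hη0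
    linarith
  have htt : ‖t - t0‖ ≤ 7 * η * G := by
    have := norm_sub_le_norm_sub_add_norm_sub t u t0
    linarith
  have htle : ‖t‖ ≤ 107 / 100 * G := by
    have := norm_le_norm_add_norm_sub' t t0
    linarith
  -- Per component: `7` from the error in `t`, a little over `1` from rounding the product `v i *
  -- t`, and a little over `1` from the subtraction, which also contributes `η ‖b i‖`.
  have key : ∀ i, ‖(y - house v *ᵥ b) i‖ ≤ ‖η * ‖b i‖ + 12 * η * G * ‖v i‖‖ := fun i => by
    refine le_trans ?_ (le_abs_self _)
    rw [Pi.sub_apply, house_mulVec_apply]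
    by_cases hi : i < k
    · rw [hy i hi, hv0 i hi]
      simp only [zero_mul, sub_zero, sub_self, norm_zero, mul_zero, add_zero]
      positivity
    · obtain ⟨h1, h2⟩ := hp i (not_lt.1 hi)
      have h1 := h1.norm_sub_le
      have h2 := h2.norm_sub_le
      change ‖y i - (b i - v i * t0)‖ ≤ _
      have hvi := norm_nonneg (v i)
      have e1 : ‖v i * t‖ ≤ 107 / 100 * (G * ‖v i‖) := by
        rw [norm_mul]
        have := mul_le_mul_of_nonneg_left htle hvi
        linarith
      have e2 : ‖v i * t - v i * t0‖ ≤ 7 * (η * G * ‖v i‖) := by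
        rw [← mul_sub, norm_mul]
        have := mul_le_mul_of_nonneg_left htt hvi
        linarith
      have e3 : ε * ‖v i * t‖ ≤ 107 / 100 * (η * G * ‖v i‖) := by
        have := mul_le_mul hεη e1 (norm_nonneg _) hη0
        linarith
      have e4 : 0 ≤ G * ‖v i‖ := by positivity
      have e4' : η * G * ‖v i‖ ≤ 1 / 100 * (G * ‖v i‖) := by
        have := mul_le_mul_of_nonneg_right hηG1 hvi
        linarith
      have e5 : ‖p i‖ ≤ 109 / 100 * (G * ‖v i‖) := by
        have := norm_le_norm_add_norm_sub' (p i) (v i * t)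
        linarith
      have e6 : ε * ‖b i - p i‖ ≤ η * ‖b i‖ + 109 / 100 * (η * G * ‖v i‖) := by
        have e7 : ‖b i - p i‖ ≤ ‖b i‖ + 109 / 100 * (G * ‖v i‖) :=
          (norm_sub_le _ _).trans (by linarith)
        have := mul_le_mul hεη e7 (norm_nonneg _) hη0
        linarith
      have e8 : y i - (b i - v i * t0) =
          (y i - (b i - p i)) - ((p i - v i * t) + (v i * t - v i * t0)) := by ring
      rw [e8]
      have e9 := norm_sub_le (y i - (b i - p i)) ((p i - v i * t) + (v i * t - v i * t0))
      have e10 := norm_add_le (p i - v i * t) (v i * t - v i * t0)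
      have e11 : 0 ≤ η * G * ‖v i‖ := by positivity
      linarith
  have h1 := l2norm_add_le (𝕜 := ℝ) (η • fun i => ‖b i‖) ((12 * η * G) • fun i => ‖v i‖)
  rw [l2norm_smul, l2norm_smul, l2norm_norm, l2norm_norm, Real.norm_of_nonneg hη0,
    Real.norm_of_nonneg (by positivity)] at h1
  have h2 := (l2norm_mono (y := η • (fun i => ‖b i‖) + (12 * η * G) • fun i => ‖v i‖) key).trans h1
  have h3 : 12 * η * G * V ≤ 24 * η * β := by
    have := mul_le_mul_of_nonneg_left hcV (mul_nonneg hη0 hβ0)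
    rw [hG]
    nlinarith
  have h4 : 0 ≤ η * β := by positivity
  change _ ≤ η * β + 12 * η * G * V at h2
  linarith

end Reflector

/-! ### Computed Householder vectors: phase, pivot and annihilation of the column -/

section ReflectorConstruction

variable {𝕜 : Type*} [RCLike 𝕜] {n : ℕ} {ε η : ℝ}

theorem isNearReflector_of_flNormSq (hε : 0 ≤ ε) (hεη : ε ≤ η) (hη : (1 + ε) ^ (n + 1) ≤ 1 + η)
    (hη1 : η ≤ 1 / 100) {k : Fin n} {v : Fin n → 𝕜} {ν τ : ℝ} (hv : ∀ i, i < k → v i = 0)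
    (hV : 0 < l2norm v) (hν : FlNormSq ε (Finset.Ici k) v ν) (hτ : Rnd ε (2 / ν) τ) :
    IsNearReflector η k v τ := by
  -- The relative error `θ` is forced by `τ = 2 / ‖v‖² (1 + θ)`; this is where `v ≠ 0` is needed.
  refine ⟨hv, τ * (l2norm v ^ 2 / 2) - 1, ?_, by field_simp; ring⟩
  have h1 := hν.abs_sub_le hε (card_Ici_le k) hη
  rw [sum_Ici_of_support (fun i hi => by simp [hv i hi]), ← l2norm_sq] at h1
  obtain ⟨δ, hδ, rfl⟩ := hτ
  rw [Real.norm_eq_abs] at hδ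
  set W := l2norm v ^ 2 with hW
  have hW0 : 0 < W := by positivity
  have hη0 : 0 ≤ η := hε.trans hεη
  obtain ⟨h2, h3⟩ := abs_le.1 h1
  obtain ⟨h4, h5⟩ := abs_le.1 (hδ.trans hεη)
  have hηW : η * W ≤ 1 / 100 * W := mul_le_mul_of_nonneg_right hη1 hW0.le
  have hν0 : 0 < ν := by linarith
  rw [show 2 / ν * (1 + δ) * (W / 2) - 1 = (W * (1 + δ) - ν) / ν by field_simp, abs_div,
    abs_of_pos hν0, div_le_iff₀ hν0, abs_le]
  have h6 : δ * W ≤ η * W := mul_le_mul_of_nonneg_right h5 hW0.le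
  have h7 : -η * W ≤ δ * W := mul_le_mul_of_nonneg_right h4 hW0.le
  have h8 : η * (99 / 100 * W) ≤ η * ν := mul_le_mul_of_nonneg_left (by linarith) hη0
  have h9 : 0 ≤ η * W := by positivity
  constructor <;> linarith

/-- The computed phase `s` need not have modulus one, so an exact phase `p` of `x` is fixed for
reference. Two roundings, of the modulus and of the quotient, separate `s` from `p`. -/
theorem exists_phase_norm_sub_le (hε : 0 ≤ ε) (hε1 : ε ≤ 1 / 100) {x s : 𝕜} {a : ℝ}
    (ha : Rnd ε ‖x‖ a) (hs0 : x = 0 → s = 1) (hs : x ≠ 0 → Rnd ε (x / (a : 𝕜)) s) :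
    ∃ p : 𝕜, ‖p‖ = 1 ∧ x = p * (‖x‖ : 𝕜) ∧ ‖s - p‖ ≤ 3 * ε := by
  by_cases hx : x = 0
  · refine ⟨1, by simp, by simp [hx], ?_⟩
    rw [hs0 hx]
    simpa using hε
  · have hx' : 0 < ‖x‖ := norm_pos_iff.2 hx
    have hxk : (‖x‖ : 𝕜) ≠ 0 := by exact_mod_cast hx'.ne'
    obtain ⟨δ, hδ, rfl⟩ := ha
    rw [Real.norm_eq_abs] at hδ
    obtain ⟨h1, h2⟩ := abs_le.1 hδ
    have hpos : 0 < 1 + δ := by linarith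
    have hpk : ((1 + δ : ℝ) : 𝕜) ≠ 0 := by exact_mod_cast hpos.ne'
    have hp1 : ‖x / (‖x‖ : 𝕜)‖ = 1 := by
      rw [norm_div, RCLike.norm_of_nonneg hx'.le, div_self hx'.ne']
    refine ⟨x / (‖x‖ : 𝕜), hp1, by field_simp, ?_⟩
    have h3 := (hs hx).norm_sub_le
    set q : 𝕜 := x / ((‖x‖ * (1 + δ) : ℝ) : 𝕜) with hq
    have h4 : q = x / (‖x‖ : 𝕜) * (((1 + δ)⁻¹ : ℝ) : 𝕜) := by
      rw [hq]
      push_cast at hpk ⊢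
      field_simp
    have hinv : (1 + δ)⁻¹ ≤ 100 / 99 := by
      rw [inv_le_comm₀ hpos (by norm_num)]
      linarith
    have hinv0 : 0 < (1 + δ)⁻¹ := by positivity
    have h5 : ‖q‖ ≤ 100 / 99 := by
      rw [h4, norm_mul, hp1, one_mul, RCLike.norm_of_nonneg hinv0.le]
      exact hinv
    have h6 : ‖q - x / (‖x‖ : 𝕜)‖ ≤ 100 / 99 * ε := by
      have h7 : q - x / (‖x‖ : 𝕜) = x / (‖x‖ : 𝕜) * ((-(δ * (1 + δ)⁻¹) : ℝ) : 𝕜) := by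
        have h8 : -(δ * (1 + δ)⁻¹) = (1 + δ)⁻¹ - 1 := by field_simp; ring
        rw [h4, h8]
        push_cast
        ring
      rw [h7, norm_mul, hp1, one_mul, RCLike.norm_ofReal, abs_neg, abs_mul, abs_of_pos hinv0]
      nlinarith [abs_nonneg δ]
    have h9 := norm_sub_le_norm_sub_add_norm_sub s q (x / (‖x‖ : 𝕜))
    nlinarith [mul_le_mul_of_nonneg_left h5 hε]

/-- In exact arithmetic the pivot would be `-p ξ`, with `ξ` the norm of the active part of the
column. The error `η` of the squared norm is not enlarged by the root, since `|√σ - ξ| (√σ + ξ) = |σ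
- ξ²|`; the other roundings add up. -/
theorem norm_computed_pivot_add_le (hε : 0 ≤ ε) (hεη : ε ≤ η) (hη1 : η ≤ 1 / 100) {p s α : 𝕜}
    {ξ σ ρ : ℝ} (hξ : 0 < ξ) (hp : ‖p‖ = 1) (hs : ‖s - p‖ ≤ 3 * ε)
    (hσ : |σ - ξ ^ 2| ≤ η * ξ ^ 2) (hρ : Rnd ε (√σ) ρ) (hα : Rnd ε (-(s * (ρ : 𝕜))) α) :
    ‖α + p * (ξ : 𝕜)‖ ≤ 8 * η * ξ := by
  have hη0 : 0 ≤ η := hε.trans hεη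
  obtain ⟨h1, h2⟩ := abs_le.1 hσ
  have hσ0 : 0 ≤ σ := by nlinarith [sq_nonneg ξ]
  have hss := Real.sq_sqrt hσ0
  have hs0 := Real.sqrt_nonneg σ
  have hηξ : 0 ≤ η * ξ := by positivity
  have hηξ1 : η * ξ ≤ 1 / 100 * ξ := mul_le_mul_of_nonneg_right hη1 hξ.le
  have h3 : |√σ - ξ| ≤ η * ξ := by
    have h4 : |√σ - ξ| * (√σ + ξ) ≤ η * ξ * (√σ + ξ) := by
      rw [← abs_of_nonneg (show 0 ≤ √σ + ξ by positivity), ← abs_mul,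
        abs_of_nonneg (show 0 ≤ √σ + ξ by positivity)]
      have h5 : (√σ - ξ) * (√σ + ξ) = σ - ξ ^ 2 := by rw [← hss]; ring_nf; simp [hss]
      rw [h5]
      nlinarith [mul_nonneg hηξ hs0]
    exact le_of_mul_le_mul_right h4 (by positivity)
  have h6 : √σ ≤ 101 / 100 * ξ := by linarith [(abs_le.1 h3).2]
  have h7 : |ρ - √σ| ≤ 101 / 100 * (η * ξ) := by
    have := hρ.norm_sub_le
    rw [Real.norm_eq_abs, Real.norm_of_nonneg hs0] at this
    have := mul_le_mul hεη h6 hs0 hη0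
    linarith
  have h8 : |ρ - ξ| ≤ 201 / 100 * (η * ξ) := by
    have := abs_sub_le ρ (√σ) ξ
    linarith
  have h9 : |ρ| ≤ 103 / 100 * ξ := by
    have := norm_le_norm_add_norm_sub' ρ ξ
    simp only [Real.norm_eq_abs, abs_of_pos hξ] at this
    linarith
  have h10 : ‖s * (ρ : 𝕜) - p * (ξ : 𝕜)‖ ≤ 6 * (η * ξ) := by
    have h11 : s * (ρ : 𝕜) - p * (ξ : 𝕜) = (s - p) * (ρ : 𝕜) + p * ((ρ - ξ : ℝ) : 𝕜) := by
      push_cast; ring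
    rw [h11]
    refine (norm_add_le _ _).trans ?_
    rw [norm_mul, norm_mul, hp, one_mul, RCLike.norm_ofReal, RCLike.norm_ofReal]
    have := mul_le_mul (hs.trans (mul_le_mul_of_nonneg_left hεη (by norm_num))) h9
      (abs_nonneg _) (by positivity)
    linarith
  have h12 : ‖s * (ρ : 𝕜)‖ ≤ 106 / 100 * ξ := by
    have := norm_le_norm_add_norm_sub' (s * (ρ : 𝕜)) (p * (ξ : 𝕜))
    rw [norm_mul p, hp, one_mul, RCLike.norm_of_nonneg hξ.le] at this
    linarith
  have h13 := hα.norm_sub_le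
  rw [norm_neg] at h13
  have h14 := mul_le_mul hεη h12 (norm_nonneg _) hη0
  have h15 : α + p * (ξ : 𝕜) = (α - -(s * (ρ : 𝕜))) - (s * (ρ : 𝕜) - p * (ξ : 𝕜)) := by ring
  rw [h15]
  have := norm_sub_le (α - -(s * (ρ : 𝕜))) (s * (ρ : 𝕜) - p * (ξ : 𝕜))
  linarith

/-- The pivot part of the estimate `|‖v‖² - 2 v^* x| = O(η ‖x‖²)` for a computed Householder
vector `v ≈ x - α e_k`. -/
theorem norm_pivot_defect_le (hη0 : 0 ≤ η) (hη1 : η ≤ 1 / 100) {p x α e : 𝕜} {ξ : ℝ}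
    (hξ : 0 < ξ) (hp : ‖p‖ = 1) (hx : x = p * (‖x‖ : 𝕜)) (hxξ : ‖x‖ ≤ ξ)
    (hα : ‖α + p * (ξ : 𝕜)‖ ≤ 8 * η * ξ) (he : ‖e‖ ≤ η * ‖x - α‖) :
    ‖e‖ ≤ 3 * η * ξ ∧ 89 / 100 * ξ ≤ ‖x - α + e‖ ∧
    ‖star (x - α + e) * (x - α + e - 2 * x) - (ξ : 𝕜) ^ 2 + (‖x‖ : 𝕜) ^ 2‖ ≤ 60 * η * ξ ^ 2 := by
  have hηξ : 0 ≤ η * ξ := by positivity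
  have hηξ1 : η * ξ ≤ 1 / 100 * ξ := mul_le_mul_of_nonneg_right hη1 hξ.le
  set β := α + p * (ξ : 𝕜) with hβ
  have hpξ : ‖p * (ξ : 𝕜)‖ = ξ := by rw [norm_mul, hp, one_mul, RCLike.norm_of_nonneg hξ.le]
  have hαβ : α = β - p * (ξ : 𝕜) := by rw [hβ]; ring
  have h1 : ‖α‖ ≤ 108 / 100 * ξ := by
    have := norm_sub_le β (p * (ξ : 𝕜))
    rw [← hαβ, hpξ] at this
    linarith
  have h2 : ‖x - α‖ ≤ 208 / 100 * ξ := by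
    have := norm_sub_le x α
    linarith
  -- The sign choice avoids cancellation: `x` and `-α` share the phase `p` up to `β`, so their
  -- moduli add.
  have h3 : 92 / 100 * ξ ≤ ‖x - α‖ := by
    have h4 : x - α = p * ((‖x‖ + ξ : ℝ) : 𝕜) - β := by
      rw [hαβ]
      nth_rw 1 [hx]
      push_cast
      ring
    have h5 := norm_sub_norm_le (p * ((‖x‖ + ξ : ℝ) : 𝕜)) β
    rw [← h4, norm_mul, hp, one_mul, RCLike.norm_of_nonneg (by positivity)] at h5
    have := norm_nonneg x
    linarith
  have h6 : ‖e‖ ≤ 208 / 100 * (η * ξ) := by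
    have := mul_le_mul_of_nonneg_left h2 hη0
    linarith
  have h7 : 89 / 100 * ξ ≤ ‖x - α + e‖ := by
    have := norm_sub_le (x - α + e) e
    rw [add_sub_cancel_right] at this
    linarith
  refine ⟨by linarith, h7, ?_⟩
  have hpp : (starRingEnd 𝕜) p * p = 1 := by rw [RCLike.conj_mul, hp]; simp
  have hxx : (starRingEnd 𝕜) x * x = (‖x‖ : 𝕜) ^ 2 := RCLike.conj_mul x
  -- The product of `conj (p ξ)` and `x = p ‖x‖` is real, so the main part of `α` drops out of this
  -- difference and only the small `β` remains.
  have hcross : (starRingEnd 𝕜) α * x - (starRingEnd 𝕜) x * α =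
      (starRingEnd 𝕜) β * x - (starRingEnd 𝕜) x * β := by
    have h8 : (starRingEnd 𝕜) x = (starRingEnd 𝕜) p * (‖x‖ : 𝕜) := by
      conv_lhs => rw [hx]
      simp
    have h9 : (starRingEnd 𝕜) p * x = (‖x‖ : 𝕜) := by
      conv_lhs => rw [hx, ← mul_assoc, hpp, one_mul]
    rw [hαβ, map_sub, map_mul, RCLike.conj_ofReal]
    linear_combination (-(ξ : 𝕜)) * h9 + p * (ξ : 𝕜) * h8 + (ξ : 𝕜) * (‖x‖ : 𝕜) * hpp
  have hid : star (x - α + e) * (x - α + e - 2 * x) - (ξ : 𝕜) ^ 2 + (‖x‖ : 𝕜) ^ 2 =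
      ((‖α‖ ^ 2 - ξ ^ 2 : ℝ) : 𝕜) + ((starRingEnd 𝕜) β * x - (starRingEnd 𝕜) x * β) +
      (star (x - α) * e + star e * (-x - α + e)) := by
    rw [← hcross, ← hxx]
    push_cast
    rw [← RCLike.conj_mul α]
    simp only [RCLike.star_def, map_add, map_sub]
    ring
  rw [hid]
  have e1 : ‖((‖α‖ ^ 2 - ξ ^ 2 : ℝ) : 𝕜)‖ ≤ 17 * η * ξ ^ 2 := by
    rw [RCLike.norm_ofReal, show ‖α‖ ^ 2 - ξ ^ 2 = (‖α‖ - ξ) * (‖α‖ + ξ) by ring, abs_mul,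
      abs_of_nonneg (show 0 ≤ ‖α‖ + ξ by positivity)]
    have h10 : |‖α‖ - ξ| ≤ 8 * η * ξ := by
      have := abs_norm_sub_norm_le α (-(p * (ξ : 𝕜)))
      rw [norm_neg, hpξ, sub_neg_eq_add] at this
      exact this.trans hα
    have := mul_le_mul h10 (show ‖α‖ + ξ ≤ 208 / 100 * ξ by linarith) (by positivity)
      (by positivity)
    nlinarith [mul_nonneg hηξ hξ.le]
  have e2 : ‖(starRingEnd 𝕜) β * x - (starRingEnd 𝕜) x * β‖ ≤ 16 * η * ξ ^ 2 := by
    refine (norm_sub_le _ _).trans ?_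
    rw [norm_mul, norm_mul, RCLike.norm_conj, RCLike.norm_conj]
    have := mul_le_mul hα hxξ (norm_nonneg _) (by positivity)
    nlinarith
  have e3 : ‖star (x - α) * e‖ ≤ 5 * η * ξ ^ 2 := by
    rw [norm_mul, norm_star]
    have := mul_le_mul h2 h6 (norm_nonneg _) (by positivity)
    nlinarith [mul_nonneg hηξ hξ.le]
  have e4 : ‖star e * (-x - α + e)‖ ≤ 5 * η * ξ ^ 2 := by
    rw [norm_mul, norm_star]
    have h11 : ‖-x - α + e‖ ≤ 212 / 100 * ξ := by
      have a1 := norm_add_le (-x - α) e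
      have a2 := norm_sub_le (-x) α
      rw [norm_neg] at a2
      linarith
    have := mul_le_mul h6 h11 (norm_nonneg _) (by positivity)
    nlinarith [mul_nonneg hηξ hξ.le]
  have e5 := norm_add_le (((‖α‖ ^ 2 - ξ ^ 2 : ℝ) : 𝕜) +
    ((starRingEnd 𝕜) β * x - (starRingEnd 𝕜) x * β)) (star (x - α) * e + star e * (-x - α + e))
  have e6 := norm_add_le (((‖α‖ ^ 2 - ξ ^ 2 : ℝ) : 𝕜))
    ((starRingEnd 𝕜) β * x - (starRingEnd 𝕜) x * β)
  have e7 := norm_add_le (star (x - α) * e) (star e * (-x - α + e))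
  nlinarith [mul_nonneg hηξ hξ.le]

theorem sum_eq_add_sum_Ioi_of_support {M : Type*} [AddCommMonoid M] {k : Fin n} {f : Fin n → M}
    (h : ∀ i, i < k → f i = 0) : ∑ i, f i = f k + ∑ i ∈ Finset.Ioi k, f i := by
  rw [← sum_Ici_of_support h, Finset.Ici_eq_cons_Ioi, Finset.sum_cons]

/-- An exact reflector along `v = x - z` maps `x` to `z` precisely when `‖v‖² = 2 v^* x`. Here `v =
x - z + e e_k`, and the defect `d = ‖v‖² - 2 v^* x` is of order `η ξ²`, while `‖v‖` is at least
`0.89 ξ`. The residual is therefore `e e_k - (d / ‖v‖²) v`, of order `η ξ`. -/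
theorem FlReflector.near (hε : 0 ≤ ε) (hεη : ε ≤ η) (hη : (1 + ε) ^ (n + 1) ≤ 1 + η)
    (hη1 : η ≤ 1 / 100) {k : Fin n} {x v z : Fin n → 𝕜} {τ : ℝ}
    (h : FlReflector ε k x v τ (z k)) (hz : ∀ i, i < k → z i = x i) (hz' : ∀ i, k < i → z i = 0) :
    IsNearReflector η k v τ ∧ l2norm (z - house v *ᵥ x) ≤ 100 * η * l2norm x := by
  have hη0 : 0 ≤ η := hε.trans hεη
  rcases h with ⟨hx, rfl, rfl, hα⟩ | ⟨⟨i₀, hi₀, hxi₀⟩, σ, ρ, a, ν, s, hσ, hρ, ha, hs0, hs, hα, hv0,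
    hvk, hvi, hν, hτ⟩
  -- A skipped reflection fits the same description: with `v = 0` the quotient `2 / ‖v‖²` is `0` and
  -- the exact reflector is the identity.
  · refine ⟨⟨fun _ _ => rfl, 0, by simpa using hη0, by simp [l2norm_zero]⟩, ?_⟩
    have h1 : z - house 0 *ᵥ x = 0 := by
      ext i
      rw [Pi.sub_apply, house_mulVec_apply]
      rcases lt_trichotomy i k with hi | rfl | hi
      · simp [hz i hi]
      · simp [hα]
      · simp [hz' i hi, hx i hi]
    rw [h1, l2norm_zero]
    have := l2norm_nonneg x
    positivity
  · obtain ⟨p, hp, hpx, hsp⟩ := exists_phase_norm_sub_le hε (hεη.trans hη1) ha hs0 hs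
    set R := ∑ i ∈ Finset.Ioi k, ‖x i‖ ^ 2 with hR
    have hR0 : 0 ≤ R := Finset.sum_nonneg fun _ _ => by positivity
    set S := ∑ i ∈ Finset.Ici k, ‖x i‖ ^ 2 with hS
    have hSR : S = ‖x k‖ ^ 2 + R := by rw [hS, Finset.Ici_eq_cons_Ioi, Finset.sum_cons]
    have hS0 : 0 < S := Finset.sum_pos' (fun _ _ => by positivity)
      ⟨i₀, by simpa using hi₀, by have := norm_pos_iff.2 hxi₀; positivity⟩
    set ξ := √S with hξ
    have hξ0 : 0 < ξ := Real.sqrt_pos.2 hS0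
    have hξ2 : ξ ^ 2 = S := Real.sq_sqrt hS0.le
    have hξx : ξ ≤ l2norm x := Real.sqrt_le_sqrt
      (Finset.sum_le_sum_of_subset_of_nonneg (Finset.subset_univ _) fun _ _ _ => by positivity)
    have hxkξ : ‖x k‖ ≤ ξ := Real.le_sqrt_of_sq_le (by linarith)
    have hσ' := hσ.abs_sub_le hε (card_Ici_le k) hη
    rw [← hS, ← hξ2] at hσ'
    have hαp := norm_computed_pivot_add_le hε hεη hη1 hξ0 hp hsp hσ' hρ hα
    set e := v k - (x k - z k) with he
    have hek : x k - z k + e = v k := by rw [he]; ring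
    have hel : ‖e‖ ≤ η * ‖x k - z k‖ :=
      hvk.norm_sub_le.trans (mul_le_mul_of_nonneg_right hεη (norm_nonneg _))
    obtain ⟨b1, b2, b3⟩ := norm_pivot_defect_le hη0 hη1 hξ0 hp hpx hxkξ hαp hel
    rw [hek] at b2 b3
    have hVk : 89 / 100 * ξ ≤ l2norm v := b2.trans (norm_apply_le_l2norm v k)
    have hV : 0 < l2norm v := by linarith
    have hnear := isNearReflector_of_flNormSq hε hεη hη hη1 hv0 hV hν hτ
    refine ⟨hnear, ?_⟩
    have hRv : ∑ i ∈ Finset.Ioi k, ‖v i‖ ^ 2 = R :=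
      Finset.sum_congr rfl fun i hi => by rw [hvi i (by simpa using hi)]
    have hV2 : l2norm v ^ 2 = ‖v k‖ ^ 2 + R := by
      rw [l2norm_sq, sum_eq_add_sum_Ioi_of_support (fun i hi => by simp [hv0 i hi]), hRv]
    have hvx : star v ⬝ᵥ x = star (v k) * x k + (R : 𝕜) := by
      rw [dotProduct, sum_eq_add_sum_Ioi_of_support (fun i hi => by simp [hv0 i hi]), hR]
      push_cast
      congr 1
      refine Finset.sum_congr rfl fun i hi => ?_
      rw [Pi.star_apply, hvi i (by simpa using hi), RCLike.star_def, RCLike.conj_mul]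
    set d : 𝕜 := star (v k) * (v k - 2 * x k) - (ξ : 𝕜) ^ 2 + (‖x k‖ : 𝕜) ^ 2 with hd
    -- Below the pivot `v` and `x` agree, so the tail contributes `R - 2 R = -R`, and `R = ξ² - ‖x
    -- k‖²`. The defect thus depends on the pivot entry alone.
    have hdR : d = ((l2norm v ^ 2 : ℝ) : 𝕜) - 2 * (star v ⬝ᵥ x) := by
      have h1 : (ξ : 𝕜) ^ 2 = (‖x k‖ : 𝕜) ^ 2 + (R : 𝕜) := by
        exact_mod_cast congrArg (fun y : ℝ => (y : 𝕜)) (hξ2.trans hSR)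
      have h2 : star (v k) * v k = (‖v k‖ : 𝕜) ^ 2 := RCLike.conj_mul (v k)
      rw [hd, h1, hvx, hV2]
      push_cast
      linear_combination h2
    have hVne : ((l2norm v : ℝ) : 𝕜) ≠ 0 := by exact_mod_cast hV.ne'
    have hdecomp : z - house v *ᵥ x =
        Pi.single k e + (-(d / ((l2norm v : ℝ) : 𝕜) ^ 2)) • v := by
      ext i
      rw [Pi.sub_apply, house_mulVec_apply, Pi.add_apply, Pi.smul_apply, smul_eq_mul, hdR]
      push_cast
      have h3 : x i - z i = v i - (Pi.single k e : Fin n → 𝕜) i := by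
        rcases lt_trichotomy i k with hi | rfl | hi
        · rw [hz i hi, hv0 i hi, Pi.single_eq_of_ne hi.ne]; ring
        · rw [Pi.single_eq_same, he]; ring
        · rw [hz' i hi, hvi i hi, Pi.single_eq_of_ne hi.ne']
      field_simp
      linear_combination (-((l2norm v : ℝ) : 𝕜) ^ 2) * h3
    rw [hdecomp]
    have h4 := l2norm_add_le (Pi.single k e) ((-(d / ((l2norm v : ℝ) : 𝕜) ^ 2)) • v)
    have h5 : l2norm (Pi.single k e : Fin n → 𝕜) = ‖e‖ := by
      rw [l2norm_eq_norm]
      exact PiLp.norm_single 2 (fun _ => 𝕜) k e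
    rw [l2norm_smul, h5, norm_neg, norm_div, norm_pow, RCLike.norm_of_nonneg hV.le] at h4
    have h6 : ‖d‖ / l2norm v ^ 2 * l2norm v ≤ 60 * η * ξ ^ 2 / (89 / 100 * ξ) := by
      have h7 : ‖d‖ / l2norm v ^ 2 * l2norm v = ‖d‖ / l2norm v := by field_simp
      rw [h7]
      gcongr
    have h8 : 60 * η * ξ ^ 2 / (89 / 100 * ξ) = 6000 / 89 * (η * ξ) := by field_simp; ring
    have h9 := mul_le_mul_of_nonneg_left hξx hη0
    have h10 := mul_nonneg hη0 hξ0.le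
    linarith

end ReflectorConstruction

/-! ### Accumulation of reflections -/

section Accumulation

variable {𝕜 : Type*} [RCLike 𝕜] {n m : ℕ} {ε η κ : ℝ}

/-- The exact product `H_0 H_1 ⋯ H_{k-1}` of the reflectors with Householder vectors `v`. -/
def houseProd (v : Fin n → Fin n → 𝕜) : ℕ → Matrix (Fin n) (Fin n) 𝕜
  | 0 => 1
  | k + 1 => houseProd v k * if h : k < n then house (v ⟨k, h⟩) else 1

theorem houseProd_succ (v : Fin n → Fin n → 𝕜) (k : Fin n) :
    houseProd v (k + 1) = houseProd v k * house (v k) := by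
  rw [houseProd, dif_pos k.2]

theorem houseProd_mem_unitaryGroup (v : Fin n → Fin n → 𝕜) (k : ℕ) :
    houseProd v k ∈ unitaryGroup (Fin n) 𝕜 := by
  induction k with
  | zero => exact one_mem _
  | succ k ih =>
    rw [houseProd]
    refine mul_mem ih ?_
    split_ifs
    · exact house_mem_unitaryGroup _
    · exact one_mem _

theorem conjTranspose_mul_self_of_mem_unitaryGroup {U : Matrix (Fin n) (Fin n) 𝕜}
    (hU : U ∈ unitaryGroup (Fin n) 𝕜) : Uᴴ * U = 1 :=
  mem_unitaryGroup_iff'.1 hU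

theorem l2norm_mul_house_mulVec_sub {U : Matrix (Fin n) (Fin n) 𝕜}
    (hU : U ∈ unitaryGroup (Fin n) 𝕜) (v y b : Fin n → 𝕜) :
    l2norm ((U * house v) *ᵥ y - U *ᵥ b) = l2norm (y - house v *ᵥ b) := by
  have h : (U * house v) *ᵥ y - U *ᵥ b = (U * house v) *ᵥ (y - house v *ᵥ b) := by
    rw [mulVec_sub, mulVec_mulVec, mul_assoc, house_mul_self, mul_one]
  rw [h, l2norm_mulVec_of_isometry
    (conjTranspose_mul_self_of_mem_unitaryGroup (mul_mem hU (house_mem_unitaryGroup v)))]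

/-- Each step is measured against the current vector, whose norm exceeds that of `a 0` by at most
the drift so far; hence compound growth. -/
theorem l2norm_sub_le_of_relative_steps {ι : Type*} [Fintype ι] {c : ℝ} (hc : 0 ≤ c)
    (a : ℕ → ι → 𝕜) (m : ℕ) (h : ∀ k < m, l2norm (a (k + 1) - a k) ≤ c * l2norm (a k)) :
    l2norm (a m - a 0) ≤ ((1 + c) ^ m - 1) * l2norm (a 0) := by
  induction m with
  | zero => simp [l2norm_zero]
  | succ m ih =>
    have h1 := ih fun k hk => h k (by omega)
    have h2 := h m (by omega)
    have h3 := l2norm_sub_le_sub_add_sub (a (m + 1)) (a m) (a 0)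
    have h4 := mul_le_mul_of_nonneg_left (l2norm_le_add_sub (a m) (a 0)) hc
    have h5 := mul_le_mul_of_nonneg_left h1 hc
    rw [pow_succ]
    linarith

/-- Pull the `k`-th iterate back by `H_0 ⋯ H_{k-1}`. Exact steps would leave the pulled-back vector
constant, and by unitarity each actual step moves it by a relative `100 η` at most. -/
theorem l2norm_houseProd_mulVec_sub_le (hη0 : 0 ≤ η) (hκ : (1 + 100 * η) ^ n ≤ 1 + κ)
    (hm : m ≤ n) (v : Fin n → Fin n → 𝕜) (w : ℕ → Fin n → 𝕜)
    (h : ∀ k : Fin n, (k : ℕ) < m →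
      l2norm (w (k + 1) - house (v k) *ᵥ w k) ≤ 100 * η * l2norm (w k)) :
    l2norm (houseProd v m *ᵥ w m - w 0) ≤ κ * l2norm (w 0) := by
  have h1 := l2norm_sub_le_of_relative_steps (c := 100 * η) (by positivity)
    (fun k => houseProd v k *ᵥ w k) m fun k hk => by
      have h2 := h ⟨k, by omega⟩ hk
      rw [← l2norm_mul_house_mulVec_sub (houseProd_mem_unitaryGroup v k)] at h2
      rw [show houseProd v (k + 1) = _ from houseProd_succ v ⟨k, by omega⟩]
      rwa [l2norm_mulVec_of_isometry
        (conjTranspose_mul_self_of_mem_unitaryGroup (houseProd_mem_unitaryGroup v k))]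
  simp only [houseProd, one_mulVec] at h1
  refine h1.trans (mul_le_mul_of_nonneg_right ?_ (l2norm_nonneg _))
  have := pow_le_pow_right₀ (show 1 ≤ 1 + 100 * η by linarith) hm
  linarith

theorem FlApplyAdjoint.colNorm_sub_le (hε : 0 ≤ ε) (hεη : ε ≤ η)
    (hη : (1 + ε) ^ (n + 1) ≤ 1 + η) (hη1 : η ≤ 1 / 100) (hκ : (1 + 100 * η) ^ n ≤ 1 + κ)
    (hm : m ≤ n) {v : Fin n → Fin n → 𝕜} {τ : Fin n → ℝ}
    (hv : ∀ k : Fin n, (k : ℕ) < m → IsNearReflector η k (v k) (τ k))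
    {M X : Matrix (Fin n) (Fin n) 𝕜} (h : FlApplyAdjoint ε m v τ M X) (j : Fin n) :
    colNorm (houseProd v m * X - M) j ≤ κ * colNorm M j := by
  obtain ⟨Z, rfl, rfl, hZ⟩ := h
  exact l2norm_houseProd_mulVec_sub_le (hε.trans hεη) hκ hm v (fun k i => Z k i j)
    fun k hk => (hZ k hk j).l2norm_sub_le hε hεη hη hη1 (hv k hk)

theorem FlFormQ.colNorm_sub_le (hε : 0 ≤ ε) (hεη : ε ≤ η)
    (hη : (1 + ε) ^ (n + 1) ≤ 1 + η) (hη1 : η ≤ 1 / 100) (hκ : (1 + 100 * η) ^ n ≤ 1 + κ)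
    (hm : m ≤ n) {v : Fin n → Fin n → 𝕜} {τ : Fin n → ℝ}
    (hv : ∀ k : Fin n, (k : ℕ) < m → IsNearReflector η k (v k) (τ k))
    {Q : Matrix (Fin n) (Fin n) 𝕜} (h : FlFormQ ε m v τ Q) (j : Fin n) :
    colNorm (Q - houseProd v m) j ≤ κ * colNorm (1 : Matrix (Fin n) (Fin n) 𝕜) j := by
  obtain ⟨P, hP, rfl, hstep⟩ := h
  have hη0 : 0 ≤ η := hε.trans hεη
  -- The factor is formed from the last reflector to the first, so the telescoping sequence runs
  -- through the indices `m - k`: it starts at the exact column and ends at the computed one.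
  have h1 := l2norm_sub_le_of_relative_steps (c := 100 * η) (by positivity)
    (fun k => houseProd v (m - k) *ᵥ fun i => P (m - k) i j) m fun k hk => by
      have hlt : m - (k + 1) < n := by omega
      have h2 := (hstep ⟨m - (k + 1), hlt⟩ (by simp only; omega) j).l2norm_sub_le hε hεη hη hη1
        (hv ⟨m - (k + 1), hlt⟩ (by simp only; omega))
      have h3 := houseProd_succ v ⟨m - (k + 1), hlt⟩
      simp only [show m - (k + 1) + 1 = m - k by omega] at h2 h3
      rw [l2norm_mulVec_of_isometry
        (conjTranspose_mul_self_of_mem_unitaryGroup (houseProd_mem_unitaryGroup v _)), h3,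
        ← mulVec_mulVec, ← mulVec_sub, l2norm_mulVec_of_isometry
        (conjTranspose_mul_self_of_mem_unitaryGroup (houseProd_mem_unitaryGroup v _))]
      exact h2
  have h4 : (fun i => houseProd v m i j) = houseProd v m *ᵥ fun i => P m i j := by
    ext i
    rw [hP]
    exact congrFun (congrFun (mul_one (houseProd v m)) i) j |>.symm
  simp only [Nat.sub_self, Nat.sub_zero, houseProd, one_mulVec] at h1
  rw [l2norm_mulVec_of_isometry
    (conjTranspose_mul_self_of_mem_unitaryGroup (houseProd_mem_unitaryGroup v _))] at h1
  rw [colNorm_eq, colNorm_eq]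
  have h5 : (fun i => (P 0 - houseProd v m) i j) =
      (fun i => P 0 i j) - houseProd v m *ᵥ fun i => P m i j := by
    rw [← h4]; rfl
  rw [h5, ← hP]
  refine h1.trans (mul_le_mul_of_nonneg_right ?_ (l2norm_nonneg _))
  have := pow_le_pow_right₀ (show 1 ≤ 1 + 100 * η by linarith) hm
  linarith

theorem FlHouseholderQR.eq_zero_below_diagonal (hm : m ≤ n) {v : Fin n → Fin n → 𝕜}
    {τ : Fin n → ℝ} {M T : Matrix (Fin n) (Fin n) 𝕜} (h : FlHouseholderQR ε m M v τ T)
    {i j : Fin n} (hj : (j : ℕ) < m) (hij : j < i) : T i j = 0 := by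
  obtain ⟨W, -, rfl, hstep⟩ := h
  have key : ∀ k ≤ m, ∀ j : Fin n, (j : ℕ) < k → ∀ i, j < i → W k i j = 0 := by
    intro k
    induction k with
    | zero => intro _ j hj; omega
    | succ k ih =>
      intro hk j hj i hij
      obtain ⟨h1, -, -, h2, -⟩ := hstep ⟨k, by omega⟩ (by simp only; omega)
      rcases Nat.lt_succ_iff_lt_or_eq.1 hj with hj' | hj'
      · rw [h1 j hj' i]
        exact ih (by omega) j hj' i hij
      · subst hj'
        exact h2 i hij
  exact key m le_rfl j hj i hij

/-- Each column is followed separately. At step `k` it is already reduced, is the pivot column, or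
is updated; in all three cases the new column is close to the exact reflection of the old one. -/
theorem FlHouseholderQR.near (hε : 0 ≤ ε) (hεη : ε ≤ η)
    (hη : (1 + ε) ^ (n + 1) ≤ 1 + η) (hη1 : η ≤ 1 / 100) (hκ : (1 + 100 * η) ^ n ≤ 1 + κ)
    (hm : m ≤ n) {v : Fin n → Fin n → 𝕜} {τ : Fin n → ℝ} {M T : Matrix (Fin n) (Fin n) 𝕜}
    (h : FlHouseholderQR ε m M v τ T) :
    (∀ k : Fin n, (k : ℕ) < m → IsNearReflector η k (v k) (τ k)) ∧
    ∀ j, colNorm (houseProd v m * T - M) j ≤ κ * colNorm M j := by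
  have hη0 : 0 ≤ η := hε.trans hεη
  -- The first `k` steps are themselves a run of the algorithm, which gives the zero pattern of
  -- every intermediate matrix.
  have hzero := fun (k : ℕ) (hk : k ≤ m) (W : ℕ → Matrix (Fin n) (Fin n) 𝕜)
      (hW : W 0 = M) (hstep) (i j : Fin n) (hj : (j : ℕ) < k) (hij : j < i) =>
    FlHouseholderQR.eq_zero_below_diagonal (ε := ε) (m := k) (hk.trans hm) (v := v) (τ := τ)
      (M := M) (T := W k) ⟨W, hW, rfl, hstep⟩ hj hij
  obtain ⟨W, hW, rfl, hstep⟩ := h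
  have hcol : ∀ k : Fin n, (k : ℕ) < m → IsNearReflector η k (v k) (τ k) ∧
      l2norm ((fun i => W (k + 1) i k) - house (v k) *ᵥ fun i => W k i k) ≤
        100 * η * l2norm fun i => W k i k := fun k hk => by
    obtain ⟨-, h2, h3, h4, -⟩ := hstep k hk
    exact FlReflector.near (z := fun i => W (k + 1) i k) hε hεη hη hη1 h2 h3 h4
  refine ⟨fun k hk => (hcol k hk).1, fun j => ?_⟩
  subst hW
  refine l2norm_houseProd_mulVec_sub_le hη0 hκ hm v (fun k i => W k i j) fun k hk => ?_
  obtain ⟨h1, -, -, -, h5⟩ := hstep k hk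
  obtain ⟨hnear, hpiv⟩ := hcol k hk
  rcases lt_trichotomy j k with hj | rfl | hj
  -- A reduced column vanishes on the support of `v k`, so the exact reflector fixes it as well.
  · have h6 : ((fun i => W (k + 1) i j) - house (v k) *ᵥ fun i => W k i j) = 0 := by
      ext i
      rw [Pi.sub_apply, house_mulVec_apply, h1 j hj i]
      have h7 : (star (v k) ⬝ᵥ fun i => W k i j) = 0 := Finset.sum_eq_zero fun l _ => by
        rcases lt_or_ge l k with hl | hl
        · simp [hnear.1 l hl]
        · simp only [hzero k hk.le W rfl (fun k' hk' => hstep k' (hk'.trans hk)) l j hj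
            (hj.trans_le hl), mul_zero]
      rw [h7]
      simp
    rw [h6, l2norm_zero]
    have := l2norm_nonneg fun i => W k i j
    positivity
  · exact hpiv
  · exact (h5 j hj).l2norm_sub_le hε hεη hη hη1 hnear

end Accumulation

/-! ### Exact deflation of the linearization -/

section Deflation

variable {𝕜 : Type*} [RCLike 𝕜] {n r : ℕ} {κ ι : Type*}

theorem mul_stack (hr : r ≤ n) (M : Matrix ι (Fin n) 𝕜) (X : Matrix (Fin (n - r)) κ 𝕜)
    (R : Matrix (Fin r) κ 𝕜) : M * stack hr X R = omega₁ hr M * X + omega₂ hr M * R := by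
  ext i j
  rw [Matrix.mul_apply, ← (stackEquiv hr).sum_comp, Fintype.sum_sum_type]
  simp [stack, omega₁, omega₂, Matrix.mul_apply]

theorem stack_add (hr : r ≤ n) (X X' : Matrix (Fin (n - r)) κ 𝕜) (R R' : Matrix (Fin r) κ 𝕜) :
    stack hr (X + X') (R + R') = stack hr X R + stack hr X' R' := by
  ext i j
  obtain ⟨i, rfl⟩ := (stackEquiv hr).surjective i
  rcases i with i | i <;> simp [stack]

/-- The right factor `QE` restores the identity block disturbed by `QEᴴ`, so the first step only
replaces `D`, `E` by `QEᴴ D`, `QEᴴ E`. The zero rows of the latter become the zero last block row.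
The permutation then collects the rows on which `Q₂ᴴ` acts. -/
theorem deflationTransform_linA (hr : r ≤ n) {QE : Matrix (Fin n) (Fin n) 𝕜} (hQE : QEᴴ * QE = 1)
    (Q₂ B D E : Matrix (Fin n) (Fin n) 𝕜) (hE : botRows hr (QEᴴ * E) = 0) :
    deflationTransform hr QE Q₂ (linA B D E) =
      fromBlocks (redA B (topRows hr (QEᴴ * D))
        (Q₂ᴴ * stack hr (botRows hr (QEᴴ * D)) (topRows hr (QEᴴ * E))))
        (fromRows 0 (-omega₁ hr Q₂ᴴ)) 0 0 := by
  have h1 : ((fromBlocks (fromBlocks 1 0 0 QEᴴ) 0 0 (fromBlocks 1 0 0 QEᴴ) :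
        Matrix (LinIdx n) (LinIdx n) 𝕜) * linA B D E *
      (fromBlocks 1 0 0 (fromBlocks 1 0 0 QE) : Matrix (LinIdx n) (LinIdx n) 𝕜)) =
      linA B (QEᴴ * D) (QEᴴ * E) := by
    simp [linA, fromBlocks_multiply, hQE, ← fromBlocks_one, fromBlocks_neg]
  have h2 : (linA B (QEᴴ * D) (QEᴴ * E)).submatrix (rowPerm hr) (colPart hr) =
      fromBlocks (redA B (topRows hr (QEᴴ * D))
        (stack hr (botRows hr (QEᴴ * D)) (topRows hr (QEᴴ * E))))
        (fromRows 0 (-omega₁ hr 1)) 0 0 := by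
    ext i j
    rcases i with ((i | (i | i)) | i) | i
    · rcases j with ((j | j) | (j | j)) | j <;>
        simp [rowPerm, colPart, linA, redA, Matrix.one_apply]
    · rcases j with ((j | j) | (j | j)) | j <;>
        simp [rowPerm, colPart, linA, redA, Matrix.one_apply, topRows]
    · rcases j with ((j | j) | (j | j)) | j <;>
        simp [rowPerm, colPart, linA, redA, Matrix.one_apply]
    · obtain ⟨i, rfl⟩ := (stackEquiv hr).surjective i
      rcases i with i | i <;> rcases j with ((j | j) | (j | j)) | j <;>
        simp [rowPerm, colPart, linA, redA, Matrix.one_apply, topRows, botRows, stack, omega₁]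
    · have hEi : ∀ j, (QEᴴ * E) (splitEquiv hr (Sum.inr i)) j = 0 := fun j =>
        congrFun (congrFun hE i) j
      rcases j with ((j | j) | (j | j)) | j <;>
        simp [rowPerm, colPart, linA, hEi]
  rw [deflationTransform, h1, h2, redA, redA]
  have h3 : Q₂ᴴ * omega₁ hr (1 : Matrix (Fin n) (Fin n) 𝕜) = omega₁ hr Q₂ᴴ := by
    ext i j
    simp [omega₁, Matrix.mul_apply, Matrix.one_apply]
  simp [fromBlocks_multiply, fromBlocks_mul_fromRows, mul_fromCols, h3]

/-- The second block column is not transformed from the right, which is why `QEᴴ` survives there,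
split into its leading and trailing rows. The stacked blocks meet `Q₂ᴴ` with one half zero, leaving
only `omega₁` or `omega₂`. -/
theorem deflationTransform_linB (hr : r ≤ n) {QE : Matrix (Fin n) (Fin n) 𝕜} (hQE : QEᴴ * QE = 1)
    (Q₂ A C : Matrix (Fin n) (Fin n) 𝕜) :
    deflationTransform hr QE Q₂ (linB A C) =
      fromBlocks (redB A (topRows hr (QEᴴ * C)) (topRows hr QEᴴ)
        (omega₁ hr Q₂ᴴ * botRows hr (QEᴴ * C)) (omega₁ hr Q₂ᴴ * botRows hr QEᴴ) 0
        (-omega₂ hr Q₂ᴴ)) 0 0 (-1) := by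
  have h1 : ((fromBlocks (fromBlocks 1 0 0 QEᴴ) 0 0 (fromBlocks 1 0 0 QEᴴ) :
        Matrix (LinIdx n) (LinIdx n) 𝕜) * linB A C *
      (fromBlocks 1 0 0 (fromBlocks 1 0 0 QE) : Matrix (LinIdx n) (LinIdx n) 𝕜)) =
      fromBlocks (fromBlocks (-A) 0 (-(QEᴴ * C)) (-QEᴴ)) 0 0 (-1) := by
    simp [linB, fromBlocks_multiply, hQE, ← fromBlocks_one, fromBlocks_neg]
  have h2 : (fromBlocks (fromBlocks (-A) 0 (-(QEᴴ * C)) (-QEᴴ)) 0 0 (-1) :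
        Matrix (LinIdx n) (LinIdx n) 𝕜).submatrix (rowPerm hr) (colPart hr) =
      fromBlocks (redB A (topRows hr (QEᴴ * C)) (topRows hr QEᴴ)
        (stack hr (botRows hr (QEᴴ * C)) 0) (stack hr (botRows hr QEᴴ) 0) 0
        (-omega₂ hr 1)) 0 0 (-1) := by
    ext i j
    rcases i with ((i | (i | i)) | i) | i
    · rcases j with ((j | j) | (j | j)) | j <;>
        simp [rowPerm, colPart, redB]
    · rcases j with ((j | j) | (j | j)) | j <;>
        simp [rowPerm, colPart, redB, topRows]
    · rcases j with ((j | j) | (j | j)) | j <;>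
        simp [rowPerm, colPart, redB, Matrix.one_apply]
    · obtain ⟨i, rfl⟩ := (stackEquiv hr).surjective i
      rcases i with i | i <;> rcases j with ((j | j) | (j | j)) | j <;>
        simp [rowPerm, colPart, redB, Matrix.one_apply, botRows, stack, omega₂]
    · rcases j with ((j | j) | (j | j)) | j <;>
        simp [rowPerm, colPart, Matrix.one_apply]
  rw [deflationTransform, h1, h2, redB, redB]
  have h3 : Q₂ᴴ * omega₂ hr (1 : Matrix (Fin n) (Fin n) 𝕜) = omega₂ hr Q₂ᴴ := by
    ext i j
    simp [omega₂, Matrix.mul_apply, Matrix.one_apply]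
  simp [fromBlocks_multiply, mul_fromCols, h3, mul_stack]

theorem redB_add_forwardPert (A : Matrix (Fin n) (Fin n) 𝕜) (Y₁ U dU : Matrix (Fin r) (Fin n) 𝕜)
    (N₁ N₂ N₃ dN₁ dN₂ : Matrix (Fin n) (Fin n) 𝕜) (N₄ dN₄ : Matrix (Fin n) (Fin r) 𝕜) :
    redB A Y₁ U N₁ N₂ N₃ N₄ + forwardPert dU dN₁ dN₂ dN₄ =
      redB A Y₁ (U + dU) (N₁ - dN₁) (N₂ - dN₂) N₃ (N₄ + dN₄) := by
  ext i j
  rcases i with (i | (i | i)) | i <;> rcases j with (j | j) | (j | j) <;>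
    simp [redB, forwardPert] <;> ring

end Deflation

/-! ### Backward errors of the computed steps -/

section BackwardErrors

variable {𝕜 : Type*} [RCLike 𝕜] {n r : ℕ} {ε η κ δ : ℝ}

/-- Error levels valid in dimension `n` for unit roundoff `ε`: `η` for sums of products, `κ` for a
sequence of reflections, relative to a vector, `δ` for a computed unitary matrix. -/
structure ErrorLevels (n : ℕ) (ε η κ δ : ℝ) : Prop where
  nonneg : 0 ≤ ε
  le_eta : ε ≤ η
  pow_le_eta : (1 + ε) ^ (n + 1) ≤ 1 + η
  eta_le : η ≤ 1 / 100
  pow_le_kappa : (1 + 100 * η) ^ n ≤ 1 + κ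
  kappa_nonneg : 0 ≤ κ
  kappa_le_delta : κ ≤ δ
  kappa_mul_le : κ * √n ≤ δ
  eta_mul_le : η * (√n + 1) ≤ δ
  delta_le : δ ≤ 1 / 100

theorem ErrorLevels.eta_nonneg (h : ErrorLevels n ε η κ δ) : 0 ≤ η := h.nonneg.trans h.le_eta

theorem ErrorLevels.delta_nonneg (h : ErrorLevels n ε η κ δ) : 0 ≤ δ :=
  h.kappa_nonneg.trans h.kappa_le_delta

theorem frobNorm_of_mem_unitaryGroup {U : Matrix (Fin n) (Fin n) 𝕜}
    (hU : U ∈ unitaryGroup (Fin n) 𝕜) : frobNorm U = √n := by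
  rw [← mul_one U, frobNorm_mul_of_isometry (conjTranspose_mul_self_of_mem_unitaryGroup hU),
    frobNorm_one, Fintype.card_fin]

theorem conjTranspose_mem_unitaryGroup {U : Matrix (Fin n) (Fin n) 𝕜}
    (hU : U ∈ unitaryGroup (Fin n) 𝕜) : Uᴴ ∈ unitaryGroup (Fin n) 𝕜 :=
  Unitary.star_mem hU

theorem ErrorLevels.householderQR (h : ErrorLevels n ε η κ δ) {m : ℕ} (hm : m ≤ n)
    {v : Fin n → Fin n → 𝕜} {τ : Fin n → ℝ} {M T Q : Matrix (Fin n) (Fin n) 𝕜}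
    (hT : FlHouseholderQR ε m M v τ T) (hQ : FlFormQ ε m v τ Q) :
    frobNorm (Q - houseProd v m) ≤ δ ∧
    ∀ j, colNorm (houseProd v m * T - M) j ≤ κ * colNorm M j := by
  obtain ⟨h1, h2⟩ := hT.near h.nonneg h.le_eta h.pow_le_eta h.eta_le h.pow_le_kappa hm
  refine ⟨?_, h2⟩
  have h3 := frobNorm_le_of_colNorm_le h.kappa_nonneg
    (hQ.colNorm_sub_le h.nonneg h.le_eta h.pow_le_eta h.eta_le h.pow_le_kappa hm h1)
  rw [frobNorm_one, Fintype.card_fin] at h3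
  exact h3.trans h.kappa_mul_le

/-- Forward error of a product with a matrix close to a given one. -/
theorem ErrorLevels.matMul (h : ErrorLevels n ε η κ δ) {ι ι' μ : Type*} [Fintype ι] [Fintype ι']
    {V W : Matrix ι ι' 𝕜} {Y : Matrix ι' μ 𝕜} {Z : Matrix ι μ 𝕜} (hι : Fintype.card ι' ≤ n)
    (hV : frobNorm V ≤ √n + 1) (hVW : frobNorm (V - W) ≤ δ) (hZ : FlMatMul ε V Y Z) (j : μ) :
    colNorm (Z - W * Y) j ≤ 2 * δ * colNorm Y j := by
  have h1 := hZ.colNorm_sub_le h.nonneg hι h.eta_nonneg h.pow_le_eta j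
  have h2 := colNorm_mul_le (V - W) Y j
  have h3 := colNorm_add_le (Z - V * Y) ((V - W) * Y) j
  rw [show Z - V * Y + (V - W) * Y = Z - W * Y by rw [Matrix.sub_mul]; abel] at h3
  have hY := colNorm_nonneg Y j
  have h4 := mul_le_mul_of_nonneg_right hVW hY
  have h5 : η * frobNorm V ≤ δ := (mul_le_mul_of_nonneg_left hV h.eta_nonneg).trans h.eta_mul_le
  have h6 := mul_le_mul_of_nonneg_right h5 hY
  linarith

theorem ErrorLevels.frobNorm_le (h : ErrorLevels n ε η κ δ) {Q U : Matrix (Fin n) (Fin n) 𝕜}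
    (hU : U ∈ unitaryGroup (Fin n) 𝕜) (hQ : frobNorm (Q - U) ≤ δ) : frobNorm Q ≤ √n + 1 := by
  have h1 := frobNorm_add_le U (Q - U)
  rw [add_sub_cancel, frobNorm_of_mem_unitaryGroup hU] at h1
  linarith [h.delta_le]

theorem frobNorm_conjTranspose_sub {ι ι' : Type*} [Fintype ι] [Fintype ι'] (Q U : Matrix ι ι' 𝕜) :
    frobNorm (Qᴴ - Uᴴ) = frobNorm (Q - U) := by
  rw [← conjTranspose_sub, frobNorm_conjTranspose]

/-- A single bound for both ways of forming the product, measured against the same unitary matrix;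
this lets the later arguments ignore which one was used. -/
theorem ErrorLevels.applied (h : ErrorLevels n ε η κ δ) {m : ℕ} (hm : m ≤ n)
    {v : Fin n → Fin n → 𝕜} {τ : Fin n → ℝ} {M T Q D X : Matrix (Fin n) (Fin n) 𝕜}
    (hT : FlHouseholderQR ε m M v τ T) (hQ : FlFormQ ε m v τ Q)
    (hX : FlMatMul ε Qᴴ D X ∨ FlApplyAdjoint ε m v τ D X) (j : Fin n) :
    colNorm (X - (houseProd v m)ᴴ * D) j ≤ 2 * δ * colNorm D j := by
  have hU := houseProd_mem_unitaryGroup v m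
  have hUQ := (h.householderQR hm hT hQ).1
  rcases hX with hX | hX
  · refine h.matMul (by simp) ?_ ?_ hX j
    · rw [frobNorm_conjTranspose]
      exact h.frobNorm_le hU hUQ
    · rwa [frobNorm_conjTranspose_sub]
  · have h1 := hX.colNorm_sub_le h.nonneg h.le_eta h.pow_le_eta h.eta_le h.pow_le_kappa hm
      (hT.near h.nonneg h.le_eta h.pow_le_eta h.eta_le h.pow_le_kappa hm).1 j
    rw [← colNorm_mul_of_isometry (conjTranspose_mul_self_of_mem_unitaryGroup
      (conjTranspose_mem_unitaryGroup hU)), mul_sub, ← mul_assoc,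
      conjTranspose_mul_self_of_mem_unitaryGroup hU, one_mul] at h1
    have h2 := mul_le_mul_of_nonneg_right h.kappa_le_delta (colNorm_nonneg D j)
    have h3 := mul_nonneg h.delta_nonneg (colNorm_nonneg D j)
    linarith

/-- A computed product `X ≈ U^* D`, written with backward errors in `D`, for the computed matrix
`Q ≈ U` and for the exactly unitary matrix `U`. -/
theorem ErrorLevels.exists_backward_errors (h : ErrorLevels n ε η κ δ)
    {Q U D X : Matrix (Fin n) (Fin n) 𝕜} (hU : U ∈ unitaryGroup (Fin n) 𝕜)
    (hQ : frobNorm (Q - U) ≤ δ) (hX : ∀ j, colNorm (X - Uᴴ * D) j ≤ 2 * δ * colNorm D j) :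
    ∃ δD ΔD : Matrix (Fin n) (Fin n) 𝕜, X = Qᴴ * (D + δD) ∧ X = Uᴴ * (D + ΔD) ∧
      (∀ j, colNorm δD j ≤ 4 * δ * colNorm D j) ∧ ∀ j, colNorm ΔD j ≤ 4 * δ * colNorm D j := by
  have hU' := conjTranspose_mul_self_of_mem_unitaryGroup hU
  have hU'' := conjTranspose_mul_self_of_mem_unitaryGroup (conjTranspose_mem_unitaryGroup hU)
  have hQ' : frobNorm (Qᴴ - Uᴴ) ≤ δ := by rwa [frobNorm_conjTranspose_sub]
  -- Being within `1/100` of a unitary matrix makes `Qᴴ` injective, with an inverse of norm at most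
  -- `100/99`. The residual `X - Qᴴ D` is at most `3 δ`, and `3 · 100/99 ≤ 4`.
  have hlow : ∀ x : Fin n → 𝕜, 99 / 100 * l2norm x ≤ l2norm (Qᴴ *ᵥ x) := fun x => by
    have h1 := l2norm_le_add_sub (Uᴴ *ᵥ x) (Qᴴ *ᵥ x)
    rw [l2norm_mulVec_of_isometry hU'', l2norm_sub_rev, ← sub_mulVec] at h1
    have h2 := l2norm_mulVec_le (Qᴴ - Uᴴ) x
    have h3 := mul_le_mul_of_nonneg_right (hQ'.trans h.delta_le) (l2norm_nonneg x)
    linarith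
  have hunit : IsUnit Qᴴ := by
    rw [← Matrix.mulVec_injective_iff_isUnit]
    intro x y hxy
    have h1 := hlow (x - y)
    have h2 : Qᴴ *ᵥ (x - y) = 0 := by rw [mulVec_sub]; exact sub_eq_zero.2 hxy
    rw [h2, l2norm_zero] at h1
    ext i
    have h3 := norm_apply_le_l2norm (x - y) i
    exact sub_eq_zero.1 (norm_le_zero_iff.1 (h3.trans (by linarith)))
  have hinv : Qᴴ * (Qᴴ)⁻¹ = 1 := mul_nonsing_inv _ ((isUnit_iff_isUnit_det _).1 hunit)
  have hδ : ∀ j, 0 ≤ δ * colNorm D j := fun j => mul_nonneg h.delta_nonneg (colNorm_nonneg D j)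
  refine ⟨(Qᴴ)⁻¹ * (X - Qᴴ * D), U * X - D, ?_, ?_, fun j => ?_, fun j => ?_⟩
  · rw [mul_add, ← mul_assoc, hinv, one_mul, add_sub_cancel]
  · rw [add_sub_cancel, ← mul_assoc, hU', one_mul]
  · have h1 := hlow fun i => ((Qᴴ)⁻¹ * (X - Qᴴ * D)) i j
    have h2 : Qᴴ *ᵥ (fun i => ((Qᴴ)⁻¹ * (X - Qᴴ * D)) i j) = fun i => (X - Qᴴ * D) i j := by
      ext i
      change (Qᴴ * ((Qᴴ)⁻¹ * (X - Qᴴ * D))) i j = _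
      rw [← mul_assoc, hinv, one_mul]
    rw [h2, ← colNorm_eq, ← colNorm_eq] at h1
    have h3 := colNorm_add_le (X - Uᴴ * D) (-((Qᴴ - Uᴴ) * D)) j
    rw [show X - Uᴴ * D + -((Qᴴ - Uᴴ) * D) = X - Qᴴ * D by rw [Matrix.sub_mul]; abel,
      colNorm_neg] at h3
    have h4 := colNorm_mul_le (Qᴴ - Uᴴ) D j
    have h5 := mul_le_mul_of_nonneg_right hQ' (colNorm_nonneg D j)
    linarith [hX j, hδ j]
  · have h1 := hX j
    rw [← colNorm_mul_of_isometry hU', mul_sub, ← mul_assoc,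
      show U * Uᴴ = 1 from mem_unitaryGroup_iff.1 hU, one_mul] at h1
    linarith [hδ j]

theorem permCols_permCols_symm {R ι : Type*} (M : Matrix ι (Fin n) R) (π : Equiv.Perm (Fin n)) :
    permCols (permCols M π.symm) π = M := by
  ext i j
  simp [permCols]

theorem permCols_symm_permCols {R ι : Type*} (M : Matrix ι (Fin n) R) (π : Equiv.Perm (Fin n)) :
    permCols (permCols M π) π.symm = M := by
  ext i j
  simp [permCols]

/-- Rounding and truncation are kept apart: `δE` turns the computed factorization into the exact one
with factor `T`, and `ΔE` removes the discarded rows. A pivot is bounded by the norm of its column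
in `T`, which equals that of the same column of `(E + δE) Π`. -/
theorem ErrorLevels.exists_truncated_qr (h : ErrorLevels n ε η κ δ) {thr : ℝ} (hthr : 0 ≤ thr)
    {m : ℕ} (hm : m ≤ n) (hrm : r ≤ m) {v : Fin n → Fin n → 𝕜} {τ : Fin n → ℝ}
    {E T Q : Matrix (Fin n) (Fin n) 𝕜} (π : Equiv.Perm (Fin n))
    (hT : FlHouseholderQR ε m (permCols E π) v τ T) (hQ : FlFormQ ε m v τ Q)
    (hthresh : ∀ i j : Fin n, (i : ℕ) < r → r ≤ (j : ℕ) →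
      colNorm (T - keepRows r T) j ≤ thr * ‖T i i‖) (hT0 : r = 0 → T = 0) :
    ∃ δE ΔE : Matrix (Fin n) (Fin n) 𝕜,
      (∀ j, colNorm δE j ≤ κ * colNorm E j) ∧
      permCols (E + δE + ΔE) π = houseProd v m * keepRows r T ∧
      (∀ i j : Fin n, (i : ℕ) < r → r ≤ (j : ℕ) →
        colNorm (permCols ΔE π) j ≤ thr * colNorm (permCols (E + δE) π) i) ∧
      (∀ i j : Fin n, (j : ℕ) < r → permCols ΔE π i j = 0) ∧ (r = 0 → ΔE = 0) := by
  set U := houseProd v m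
  have hU' := conjTranspose_mul_self_of_mem_unitaryGroup (houseProd_mem_unitaryGroup v m)
  have hErr := (h.householderQR hm hT hQ).2
  have hδE : permCols (E + permCols (U * T - permCols E π) π.symm) π = U * T := by
    ext i j
    simp [permCols]
  refine ⟨permCols (U * T - permCols E π) π.symm, permCols (U * (keepRows r T - T)) π.symm,
    fun j => ?_, ?_, fun i j hi hj => ?_, fun i j hj => ?_, fun h0 => ?_⟩
  · have h1 := hErr (π.symm j)
    have h2 : colNorm (permCols E π) (π.symm j) = colNorm E j := by
      simp [colNorm, permCols]
    rwa [h2] at h1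
  · have h1 : ∀ M N : Matrix (Fin n) (Fin n) 𝕜, permCols (M + N) π = permCols M π + permCols N π :=
      fun _ _ => rfl
    rw [h1, hδE, permCols_permCols_symm, mul_sub, add_sub_cancel]
  · rw [hδE, permCols_permCols_symm, colNorm_mul_of_isometry hU', colNorm_mul_of_isometry hU',
      colNorm_sub_rev]
    exact (hthresh i j hi hj).trans
      (mul_le_mul_of_nonneg_left (norm_apply_le_l2norm (fun l => T l i) i) hthr)
  · rw [permCols_permCols_symm, Matrix.mul_apply]
    refine Finset.sum_eq_zero fun l _ => ?_
    by_cases hl : (l : ℕ) < r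
    · simp [keepRows, hl]
    -- Since `j < r ≤ m`, column `j` is fully reduced and truncation loses nothing in it.
    · have := hT.eq_zero_below_diagonal hm (i := l) (j := j) (by omega)
        (Fin.lt_def.2 (by omega))
      simp [keepRows, hl, this]
  · rw [hT0 h0]
    ext i j
    simp [permCols, keepRows, Matrix.mul_apply]

end BackwardErrors

/-! ### Blocks of unitary matrices, the second factorization and forward errors -/

section Blocks

variable {𝕜 : Type*} [RCLike 𝕜] {n r : ℕ} {ε η κ δ : ℝ}

theorem topRows_mul_conjTranspose_botRows (hr : r ≤ n) {U : Matrix (Fin n) (Fin n) 𝕜}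
    (hU : U ∈ unitaryGroup (Fin n) 𝕜) : topRows hr U * (botRows hr U)ᴴ = 0 := by
  ext i j
  have h1 := congrFun (congrFun (mem_unitaryGroup_iff.1 hU) (splitEquiv hr (Sum.inl i)))
    (splitEquiv hr (Sum.inr j))
  rw [Matrix.one_apply_ne (by simp)] at h1
  exact h1

theorem botRows_mul_conjTranspose_topRows (hr : r ≤ n) {U : Matrix (Fin n) (Fin n) 𝕜}
    (hU : U ∈ unitaryGroup (Fin n) 𝕜) : botRows hr U * (topRows hr U)ᴴ = 0 := by
  rw [← conjTranspose_conjTranspose (botRows hr U), ← conjTranspose_mul,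
    topRows_mul_conjTranspose_botRows hr hU, conjTranspose_zero]

theorem topRows_mul_conjTranspose_topRows (hr : r ≤ n) {U : Matrix (Fin n) (Fin n) 𝕜}
    (hU : U ∈ unitaryGroup (Fin n) 𝕜) : topRows hr U * (topRows hr U)ᴴ = 1 := by
  ext i j
  have h1 := congrFun (congrFun (mem_unitaryGroup_iff.1 hU) (splitEquiv hr (Sum.inl i)))
    (splitEquiv hr (Sum.inl j))
  rw [Matrix.one_apply] at h1 ⊢
  simp only [EmbeddingLike.apply_eq_iff_eq, Sum.inl.injEq] at h1
  exact h1

theorem botRows_mul_conjTranspose_botRows (hr : r ≤ n) {U : Matrix (Fin n) (Fin n) 𝕜}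
    (hU : U ∈ unitaryGroup (Fin n) 𝕜) : botRows hr U * (botRows hr U)ᴴ = 1 := by
  ext i j
  have h1 := congrFun (congrFun (mem_unitaryGroup_iff.1 hU) (splitEquiv hr (Sum.inr i)))
    (splitEquiv hr (Sum.inr j))
  rw [Matrix.one_apply] at h1 ⊢
  simp only [EmbeddingLike.apply_eq_iff_eq, Sum.inr.injEq] at h1
  exact h1

theorem conjTranspose_omega₁_mul_omega₁ (hr : r ≤ n) {U : Matrix (Fin n) (Fin n) 𝕜}
    (hU : U ∈ unitaryGroup (Fin n) 𝕜) : (omega₁ hr U)ᴴ * omega₁ hr U = 1 := by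
  ext i j
  have h1 := congrFun (congrFun (mem_unitaryGroup_iff'.1 hU) (stackEquiv hr (Sum.inl i)))
    (stackEquiv hr (Sum.inl j))
  rw [Matrix.one_apply] at h1 ⊢
  simp only [EmbeddingLike.apply_eq_iff_eq, Sum.inl.injEq] at h1
  exact h1

theorem frobNorm_topRows_le (hr : r ≤ n) (M : Matrix (Fin n) (Fin n) 𝕜) :
    frobNorm (topRows hr M) ≤ frobNorm M :=
  frobNorm_submatrix_le M ((splitEquiv hr).injective.comp Sum.inl_injective) Function.injective_id

theorem frobNorm_botRows_le (hr : r ≤ n) (M : Matrix (Fin n) (Fin n) 𝕜) :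
    frobNorm (botRows hr M) ≤ frobNorm M :=
  frobNorm_submatrix_le M ((splitEquiv hr).injective.comp Sum.inr_injective) Function.injective_id

theorem frobNorm_omega₁_le (hr : r ≤ n) (M : Matrix (Fin n) (Fin n) 𝕜) :
    frobNorm (omega₁ hr M) ≤ frobNorm M :=
  frobNorm_submatrix_le M Function.injective_id ((stackEquiv hr).injective.comp Sum.inl_injective)

theorem frobNorm_omega₂_le (hr : r ≤ n) (M : Matrix (Fin n) (Fin n) 𝕜) :
    frobNorm (omega₂ hr M) ≤ frobNorm M :=
  frobNorm_submatrix_le M Function.injective_id ((stackEquiv hr).injective.comp Sum.inr_injective)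

theorem colNorm_topRows_le {ι : Type*} (hr : r ≤ n) (M : Matrix (Fin n) ι 𝕜) (j : ι) :
    colNorm (topRows hr M) j ≤ colNorm M j :=
  colNorm_submatrix_le M ((splitEquiv hr).injective.comp Sum.inl_injective) j

theorem colNorm_botRows_le {ι : Type*} (hr : r ≤ n) (M : Matrix (Fin n) ι 𝕜) (j : ι) :
    colNorm (botRows hr M) j ≤ colNorm M j :=
  colNorm_submatrix_le M ((splitEquiv hr).injective.comp Sum.inr_injective) j

theorem colNorm_fromRows {ι ι' μ : Type*} [Fintype ι] [Fintype ι'] (M : Matrix ι μ 𝕜)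
    (N : Matrix ι' μ 𝕜) (j : μ) :
    colNorm (fromRows M N) j = √(colNorm M j ^ 2 + colNorm N j ^ 2) := by
  rw [colNorm, colNorm, colNorm, Real.sq_sqrt (by positivity), Real.sq_sqrt (by positivity),
    Fintype.sum_sum_type]
  rfl

theorem colNorm_stack {μ : Type*} (hr : r ≤ n) (X : Matrix (Fin (n - r)) μ 𝕜)
    (R : Matrix (Fin r) μ 𝕜) (j : μ) : colNorm (stack hr X R) j = colNorm (fromRows X R) j := by
  rw [colNorm, colNorm, ← (stackEquiv hr).sum_comp]
  simp [stack]

theorem exists_stack_eq {R μ : Type*} (hr : r ≤ n) (M : Matrix (Fin n) μ R) :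
    ∃ (X : Matrix (Fin (n - r)) μ R) (Z : Matrix (Fin r) μ R), stack hr X Z = M := by
  refine ⟨M.submatrix (fun i => stackEquiv hr (Sum.inl i)) id,
    M.submatrix (fun i => stackEquiv hr (Sum.inr i)) id, ?_⟩
  ext i j
  obtain ⟨i, rfl⟩ := (stackEquiv hr).surjective i
  rcases i with i | i <;> simp [stack]

/-- A matrix close to a product of an isometry and a coisometry has spectral norm close to one. -/
theorem one_sub_le_specNorm {ι ι' μ : Type*} [Fintype ι] [Fintype ι'] [DecidableEq ι'] [Fintype μ]
    [DecidableEq μ] [Nonempty μ] {W : Matrix ι μ 𝕜} {V : Matrix ι' μ 𝕜} (hW : Wᴴ * W = 1)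
    (hV : Vᴴ * V = 1) (N : Matrix ι ι' 𝕜) : 1 - frobNorm (N - W * Vᴴ) ≤ specNorm N := by
  -- Test vector `V e_i`: a unit vector that `W Vᴴ` maps to the unit vector `W e_i`.
  obtain ⟨i⟩ := ‹Nonempty μ›
  have hx : l2norm (V *ᵥ Pi.single i 1) = 1 := by
    rw [l2norm_mulVec_of_isometry hV, l2norm_eq_norm]
    exact (PiLp.norm_single 2 (fun _ => 𝕜) i 1).trans norm_one
  have hy : l2norm ((W * Vᴴ) *ᵥ (V *ᵥ Pi.single i 1)) = 1 := by
    rw [mulVec_mulVec, Matrix.mul_assoc, hV, Matrix.mul_one, l2norm_mulVec_of_isometry hW,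
      l2norm_eq_norm]
    exact (PiLp.norm_single 2 (fun _ => 𝕜) i 1).trans norm_one
  have h1 := l2norm_mulVec_le_specNorm N (V *ᵥ Pi.single i 1)
  have h2 := l2norm_mulVec_le (N - W * Vᴴ) (V *ᵥ Pi.single i 1)
  have h3 := l2norm_le_add_sub ((W * Vᴴ) *ᵥ (V *ᵥ Pi.single i 1)) (N *ᵥ (V *ᵥ Pi.single i 1))
  rw [l2norm_sub_rev, ← sub_mulVec] at h3
  rw [hx] at h1 h2
  linarith

/-- The second QR factorization is the exact one, with a unitary factor, of a perturbed matrix;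
the perturbation includes the discarded part. -/
theorem ErrorLevels.exists_second_qr (h : ErrorLevels n ε η κ δ) {θ : ℝ} (hθ : 0 ≤ θ) {m r₂ : ℕ}
    (hm : m ≤ n) {v : Fin n → Fin n → 𝕜} {τ : Fin n → ℝ} {M T : Matrix (Fin n) (Fin n) 𝕜}
    (π : Equiv.Perm (Fin n)) {Q : Matrix (Fin n) (Fin n) 𝕜}
    (hT : FlHouseholderQR ε m (permCols M π) v τ T) (hQ : FlFormQ ε m v τ Q)
    (hthr : ∀ j, colNorm (T - keepRows r₂ T) j ≤ θ * colNorm T j) (j : Fin n) :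
    colNorm (permCols (houseProd v m * keepRows r₂ T) π.symm - M) j ≤ (δ + 2 * θ) * colNorm M j := by
  set U := houseProd v m
  have hU' := conjTranspose_mul_self_of_mem_unitaryGroup (houseProd_mem_unitaryGroup v m)
  have h1 := (h.householderQR hm hT hQ).2 (π.symm j)
  have h2 := hthr (π.symm j)
  have h3 : colNorm (permCols M π) (π.symm j) = colNorm M j := by simp [colNorm, permCols]
  rw [h3] at h1
  have h4 := colNorm_le_add_sub (U * T) (permCols M π) (π.symm j)
  rw [colNorm_mul_of_isometry hU', h3] at h4
  have h5 := colNorm_add_le (U * T - permCols M π) (-(U * (T - keepRows r₂ T))) (π.symm j)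
  rw [colNorm_neg, colNorm_mul_of_isometry hU'] at h5
  have h6 : colNorm (U * T - permCols M π + -(U * (T - keepRows r₂ T))) (π.symm j) =
      colNorm (permCols (U * keepRows r₂ T) π.symm - M) j := by
    rw [show U * T - permCols M π + -(U * (T - keepRows r₂ T)) =
      U * keepRows r₂ T - permCols M π by rw [mul_sub]; abel]
    simp [colNorm, permCols]
  rw [h6] at h5
  have hM := colNorm_nonneg M j
  have h7 := mul_le_mul_of_nonneg_right h.kappa_le_delta hM
  have h8 := mul_le_mul_of_nonneg_right (h.kappa_le_delta.trans h.delta_le) hM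
  -- The discarded part is measured against `T`; since `‖T‖ ≤ (1 + κ) ‖M‖` columnwise, a factor `2`
  -- converts it.
  have h9 : θ * colNorm T (π.symm j) ≤ θ * (2 * colNorm M j) :=
    mul_le_mul_of_nonneg_left (by linarith) hθ
  linarith

/-- Forward error of `N₁` relative to the computed matrix. -/
theorem ErrorLevels.forward_error_colNorm (h : ErrorLevels n ε η κ δ) {ι μ ν : Type*} [Fintype ι]
    [Fintype μ] [DecidableEq μ] {W : Matrix ι μ 𝕜} (hW : Wᴴ * W = 1) {Y : Matrix μ ν 𝕜}
    {N : Matrix ι ν 𝕜} {j : ν} (hN : colNorm (N - W * Y) j ≤ 2 * δ * colNorm Y j) :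
    colNorm (N - W * Y) j ≤ 4 * δ * colNorm N j := by
  have h1 := colNorm_le_add_sub (W * Y) N j
  rw [colNorm_mul_of_isometry hW, colNorm_sub_rev] at h1
  have h2 := mul_le_mul_of_nonneg_right h.delta_le (colNorm_nonneg Y j)
  -- As `W` is an isometry, `‖Y‖ = ‖W Y‖ ≤ ‖N‖ + 2 δ ‖Y‖`, and the last term is absorbed.
  have h3 : colNorm Y j ≤ 2 * colNorm N j := by linarith [colNorm_nonneg Y j]
  have h4 := mul_le_mul_of_nonneg_left h3 h.delta_nonneg
  linarith

/-- Forward error of `N₂` relative to the computed matrix. -/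
theorem ErrorLevels.forward_error_specNorm (h : ErrorLevels n ε η κ δ) (hr : r ≤ n)
    (hδ : δ * (2 * √n + 3) ≤ 1 / 2)
    {Q U Q₂ U₂ N : Matrix (Fin n) (Fin n) 𝕜} (hU : U ∈ unitaryGroup (Fin n) 𝕜)
    (hQ : frobNorm (Q - U) ≤ δ) (hU₂ : U₂ ∈ unitaryGroup (Fin n) 𝕜)
    (hQ₂ : frobNorm (Q₂ - U₂) ≤ δ) (hN : FlMatMul ε (omega₁ hr Q₂) (botRows hr Q) N) :
    specNorm (N - omega₁ hr U₂ * botRows hr U) ≤ 2 * (δ * (2 * √n + 3)) * specNorm N := by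
  have hW := conjTranspose_omega₁_mul_omega₁ hr hU₂
  have h1 : ∀ j, colNorm (N - omega₁ hr U₂ * botRows hr Q) j ≤ 2 * δ * colNorm (botRows hr Q) j :=
    fun j => h.matMul (by simp) ((frobNorm_omega₁_le hr Q₂).trans (h.frobNorm_le hU₂ hQ₂))
      ((frobNorm_omega₁_le hr (Q₂ - U₂)).trans hQ₂) hN j
  have h2 := frobNorm_le_of_colNorm_le (mul_nonneg zero_le_two h.delta_nonneg) h1
  have h3 := frobNorm_add_le (N - omega₁ hr U₂ * botRows hr Q)
    (omega₁ hr U₂ * botRows hr (Q - U))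
  rw [frobNorm_mul_of_isometry hW] at h3
  have h4 : N - omega₁ hr U₂ * botRows hr Q + omega₁ hr U₂ * botRows hr (Q - U) =
      N - omega₁ hr U₂ * botRows hr U := by
    rw [show botRows hr (Q - U) = botRows hr Q - botRows hr U from rfl, Matrix.mul_sub]
    abel
  rw [h4] at h3
  have h5 := (frobNorm_botRows_le hr Q).trans (h.frobNorm_le hU hQ)
  have h6 := (frobNorm_botRows_le hr (Q - U)).trans hQ
  have h7 := mul_le_mul_of_nonneg_left h5 h.delta_nonneg
  have h8 := specNorm_le_frobNorm (N - omega₁ hr U₂ * botRows hr U)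
  have h9 : 0 ≤ δ * (2 * √n + 3) := mul_nonneg h.delta_nonneg (by positivity)
  have h0 : 0 ≤ specNorm N := specNorm_nonneg N
  -- Without trailing rows there is no lower bound for `‖N‖`, but then the absolute error is zero as
  -- well.
  rcases Nat.eq_zero_or_pos (n - r) with hnr | hnr
  · have : IsEmpty (Fin (n - r)) := by rw [hnr]; infer_instance
    have h10 : ∀ M : Matrix (Fin (n - r)) (Fin n) 𝕜, frobNorm M = 0 := fun M => by simp [frobNorm]
    rw [h10] at h2 h3
    have h11 : 0 ≤ 2 * (δ * (2 * √n + 3)) * specNorm N := by positivity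
    linarith
  · have : Nonempty (Fin (n - r)) := ⟨⟨0, hnr⟩⟩
    have h10 := one_sub_le_specNorm (V := (botRows hr U)ᴴ) hW
      (by rw [conjTranspose_conjTranspose]; exact botRows_mul_conjTranspose_botRows hr hU) N
    rw [conjTranspose_conjTranspose] at h10
    -- The absolute error is at most `2 δ (√n + 1) + δ = δ (2 √n + 3) ≤ 1/2`; the lower bound turns
    -- it into a relative error at the price of a factor `2`.
    have h11 : 1 / 2 ≤ specNorm N := by linarith
    have h12 := mul_le_mul_of_nonneg_left h11 (mul_nonneg zero_le_two h9)
    linarith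

end Blocks

/-! ### Polynomial error constants -/

section Constants

theorem MildlyGrowing.monomial {c : ℝ} (hc : 0 ≤ c) (d : ℕ) :
    MildlyGrowing fun n => c * ((n : ℝ) + 1) ^ d :=
  ⟨c, d, fun _ => ⟨by positivity, le_rfl⟩⟩

theorem MildlyGrowing.add {f g : ℕ → ℝ} (hf : MildlyGrowing f) (hg : MildlyGrowing g) :
    MildlyGrowing fun n => f n + g n := by
  obtain ⟨c, d, hf⟩ := hf
  obtain ⟨c', d', hg⟩ := hg
  refine ⟨|c| + |c'|, d + d', fun n => ⟨add_nonneg (hf n).1 (hg n).1, ?_⟩⟩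
  have h1 : (1 : ℝ) ≤ (n : ℝ) + 1 := by linarith [Nat.cast_nonneg (α := ℝ) n]
  have h2 : c * ((n : ℝ) + 1) ^ d ≤ |c| * ((n : ℝ) + 1) ^ (d + d') :=
    mul_le_mul (le_abs_self c) (pow_le_pow_right₀ h1 (by omega)) (by positivity) (abs_nonneg c)
  have h3 : c' * ((n : ℝ) + 1) ^ d' ≤ |c'| * ((n : ℝ) + 1) ^ (d + d') :=
    mul_le_mul (le_abs_self c') (pow_le_pow_right₀ h1 (by omega)) (by positivity) (abs_nonneg c')
  linarith [(hf n).2, (hg n).2]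

theorem MildlyGrowing.const_mul {f : ℕ → ℝ} {a : ℝ} (ha : 0 ≤ a) (hf : MildlyGrowing f) :
    MildlyGrowing fun n => a * f n := by
  obtain ⟨c, d, hf⟩ := hf
  exact ⟨a * c, d, fun n => ⟨mul_nonneg ha (hf n).1, by
    rw [mul_assoc]; exact mul_le_mul_of_nonneg_left (hf n).2 ha⟩⟩

theorem sqrt_natCast_le_add_one (n : ℕ) : √(n : ℝ) ≤ (n : ℝ) + 1 :=
  Real.sqrt_le_iff.2 ⟨by positivity, by nlinarith [Nat.cast_nonneg (α := ℝ) n]⟩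

/-- With `N = n + 1`: linearizing `(1 + ε) ^ N` gives `η = 2 N ε`, linearizing `(1 + 200 N ε) ^ n`
gives `κ = 400 N² ε`, and `√n ≤ N` gives `δ = 400 N³ ε`. The threshold `40000 = 100 · 400` makes `δ
≤ 1/100`. -/
theorem errorLevels_of_small {n : ℕ} {ε : ℝ} (hε : 0 ≤ ε)
    (hsmall : 40000 * ((n : ℝ) + 1) ^ 4 * ε ≤ 1) :
    ErrorLevels n ε (2 * ((n : ℝ) + 1) * ε) (400 * ((n : ℝ) + 1) ^ 2 * ε)
      (400 * ((n : ℝ) + 1) ^ 3 * ε) := by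
  have hn := Nat.cast_nonneg (α := ℝ) n
  have hs := sqrt_natCast_le_add_one n
  set N : ℝ := (n : ℝ) + 1 with hN
  have hN1 : 1 ≤ N := by linarith
  have hpow : ∀ a b : ℕ, a ≤ b → N ^ a * ε ≤ N ^ b * ε := fun a b hab =>
    mul_le_mul_of_nonneg_right (pow_le_pow_right₀ hN1 hab) hε
  have h01 := hpow 0 1 (by norm_num)
  have h12 := hpow 1 2 (by norm_num)
  have h23 := hpow 2 3 (by norm_num)
  have h34 := hpow 3 4 (by norm_num)
  simp only [pow_zero, pow_one, one_mul] at h01 h12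
  have h2 : 0 ≤ N ^ 2 * ε := by positivity
  refine ⟨hε, by linarith, ?_, by linarith, ?_, by linarith, by linarith, ?_, ?_, by linarith⟩
  · have h5 := one_add_pow_le_one_add_two_mul hε (n + 1) (by push_cast; linarith)
    push_cast at h5
    linarith
  · have h6 : (n : ℝ) * (100 * (2 * N * ε)) ≤ 200 * (N ^ 2 * ε) := by
      have : (n : ℝ) * (N * ε) ≤ N * (N * ε) :=
        mul_le_mul_of_nonneg_right (by linarith) (by positivity)
      linarith
    have h5 := one_add_pow_le_one_add_two_mul (x := 100 * (2 * N * ε)) (by positivity) n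
      (by linarith)
    linarith
  · have := mul_le_mul_of_nonneg_left hs h2
    linarith
  · have : 2 * N * ε * (√n + 1) ≤ 2 * N * ε * (2 * N) :=
      mul_le_mul_of_nonneg_left (by linarith) (by positivity)
    linarith

end Constants

end QuarticDeflation

end

/-! ### Assembly of the two steps -/

open QuarticDeflation Matrix in
theorem QuarticDeflation.ErrorLevels.mixed_stable_deflation {𝕜 : Type*} [RCLike 𝕜] {n r r₂ : ℕ} (hr : r ≤ n) {ε η κ δ θ thr : ℝ}
    (hthr : 0 ≤ thr) (hθ : 0 ≤ θ) (h : ErrorLevels n ε η κ δ)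
    (hδ : δ * (2 * √n + 3) ≤ 1 / 2)
    {A B C D E : Matrix (Fin n) (Fin n) 𝕜}
    {πE : Equiv.Perm (Fin n)} {QE : Matrix (Fin n) (Fin n) 𝕜} {RE : Matrix (Fin r) (Fin n) 𝕜}
    {X Y : Matrix (Fin n) (Fin n) 𝕜}
    {π₂ : Equiv.Perm (Fin n)} {Q₂ R₂ N₁ N₂ N₃ : Matrix (Fin n) (Fin n) 𝕜}
    {N₄ : Matrix (Fin n) (Fin r) 𝕜}
    (h₁ : ComputedFirstStep ε thr hr C D E πE QE RE X Y)
    (h₂ : ComputedSecondStep ε θ hr r₂ πE QE RE X Y π₂ Q₂ R₂ N₁ N₂ N₃ N₄) :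
      ∃ (QEhat Q₂hat δC δD δE ΔC ΔD ΔE DS ES : Matrix (Fin n) (Fin n) 𝕜)
        (Γ₁ : Matrix (Fin (n - r)) (Fin n) 𝕜) (Γ₂ : Matrix (Fin r) (Fin n) 𝕜)
        (dU : Matrix (Fin r) (Fin n) 𝕜) (dN₁ dN₂ : Matrix (Fin n) (Fin n) 𝕜)
        (dN₄ : Matrix (Fin n) (Fin r) 𝕜)
        (S : Matrix (RowIdx n r) (Fin (n - r)) 𝕜),
        QEhat ∈ Matrix.unitaryGroup (Fin n) 𝕜 ∧ Q₂hat ∈ Matrix.unitaryGroup (Fin n) 𝕜 ∧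
        frobNorm (QE - QEhat) ≤ δ ∧
        frobNorm (Q₂ - Q₂hat) ≤ δ ∧
        X = QE.conjTranspose * (D + δD) ∧ X = QEhat.conjTranspose * (D + ΔD) ∧
        Y = QE.conjTranspose * (C + δC) ∧ Y = QEhat.conjTranspose * (C + ΔC) ∧
        (∀ i, colNorm δC i ≤ 4 * δ * colNorm C i) ∧
        (∀ i, colNorm ΔC i ≤ 4 * δ * colNorm C i) ∧
        (∀ i, colNorm δD i ≤ 4 * δ * colNorm D i) ∧
        (∀ i, colNorm ΔD i ≤ 4 * δ * colNorm D i) ∧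
        (∀ i, colNorm δE i ≤ δ * colNorm E i) ∧
        topRows hr (QEhat.conjTranspose * permCols (E + δE + ΔE) πE) = RE ∧
        botRows hr (QEhat.conjTranspose * permCols (E + δE + ΔE) πE) = 0 ∧
        (∀ i j : Fin n, (i : ℕ) < r → r ≤ (j : ℕ) →
          colNorm (permCols ΔE πE) j ≤ thr * colNorm (permCols (E + δE) πE) i) ∧
        (∀ i j : Fin n, (j : ℕ) < r → permCols ΔE πE i j = 0) ∧
        (r = 0 → ΔE = 0) ∧
        DS = ΔD + (botRows hr QEhat.conjTranspose).conjTranspose * Γ₁ ∧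
        ES = δE + ΔE + (topRows hr QEhat.conjTranspose).conjTranspose * Γ₂ ∧
        (∀ i, colNorm (Matrix.fromRows Γ₁ Γ₂) i ≤
          (δ + 2 * θ) * colNorm (Matrix.fromRows (D + ΔD) (E + δE + ΔE)) i) ∧
        specNorm dU ≤ δ ∧
        specNorm dN₄ ≤ δ ∧
        (∀ i, colNorm dN₁ i ≤ 4 * δ * colNorm N₁ i) ∧
        specNorm dN₂ ≤ 2 * (δ * (2 * √n + 3)) * specNorm N₂ ∧
        deflationTransform hr QEhat Q₂hat (linA B (D + DS) (E + ES)) =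
          Matrix.fromBlocks (redA B (topRows hr X) (permCols R₂ π₂.symm)) S 0 0 ∧
        deflationTransform hr QEhat Q₂hat (linB A (C + ΔC)) =
          Matrix.fromBlocks
            (redB A (topRows hr Y) (topRows hr QE.conjTranspose) N₁ N₂ N₃ N₄ +
              forwardPert dU dN₁ dN₂ dN₄)
            0 0 (-1) := by
  obtain ⟨m, v, τ, T, hrm, hm, hT, hQ, -, hthresh, hT0, rfl, hX, hY⟩ := h₁
  obtain ⟨m', v', τ', T', -, hm', hT', hQ', -, hthr', rfl, hN₁, hN₂, rfl, rfl⟩ := h₂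
  have hU := houseProd_mem_unitaryGroup v m
  have hU₂ := houseProd_mem_unitaryGroup v' m'
  have hQU := (h.householderQR hm hT hQ).1
  have hQU₂ := (h.householderQR hm' hT' hQ').1
  obtain ⟨δD, ΔD, hD1, hD2, hD3, hD4⟩ := h.exists_backward_errors hU hQU (h.applied hm hT hQ hX)
  obtain ⟨δC, ΔC, hC1, hC2, hC3, hC4⟩ := h.exists_backward_errors hU hQU (h.applied hm hT hQ hY)
  obtain ⟨δE, ΔE, hE1, hE2, hE3, hE4, hE5⟩ :=
    h.exists_truncated_qr hthr hm hrm πE hT hQ hthresh hT0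
  have hΓ := h.exists_second_qr hθ hm' π₂ hT' hQ' hthr'
  set U := houseProd v m
  set U₂ := houseProd v' m'
  have hU' := conjTranspose_mul_self_of_mem_unitaryGroup hU
  have hU₂' := conjTranspose_mul_self_of_mem_unitaryGroup hU₂
  have hUc := conjTranspose_mem_unitaryGroup hU
  have hU₂c := conjTranspose_mem_unitaryGroup hU₂
  have hUc' := conjTranspose_mul_self_of_mem_unitaryGroup hUc
  have hQUc : frobNorm (QEᴴ - Uᴴ) ≤ δ := by rwa [frobNorm_conjTranspose_sub]
  have hQU₂c : frobNorm (Q₂ᴴ - U₂ᴴ) ≤ δ := by rwa [frobNorm_conjTranspose_sub]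
  set M := secondMatrix hr πE (topRows hr T) X with hM
  -- The residual of the second factorization, cut along the same row partition as `M`.
  obtain ⟨Γ₁, Γ₂, hΓeq⟩ := exists_stack_eq hr (permCols (U₂ * keepRows r₂ T') π₂.symm - M)
  have hEkeep : Uᴴ * permCols (E + δE + ΔE) πE = keepRows r T := by
    rw [hE2, ← Matrix.mul_assoc, hU', Matrix.one_mul]
  have hEtop : topRows hr (Uᴴ * permCols (E + δE + ΔE) πE) = topRows hr T := by
    rw [hEkeep]
    ext i j
    simp [topRows, keepRows, splitEquiv]
  have hEbot : botRows hr (Uᴴ * permCols (E + δE + ΔE) πE) = 0 := by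
    rw [hEkeep]
    ext i j
    simp [botRows, keepRows, splitEquiv]
  have hEtop' : topRows hr (Uᴴ * (E + δE + ΔE)) = permCols (topRows hr T) πE.symm := by
    rw [← hEtop]
    exact (permCols_symm_permCols (topRows hr (Uᴴ * (E + δE + ΔE))) πE).symm
  have hEbot' : botRows hr (Uᴴ * (E + δE + ΔE)) = 0 := by
    rw [← permCols_symm_permCols (botRows hr (Uᴴ * (E + δE + ΔE))) πE]
    rw [show permCols (botRows hr (Uᴴ * (E + δE + ΔE))) πE = 0 from hEbot]
    rfl
  have top_mul : ∀ Z : Matrix (Fin n) (Fin n) 𝕜, topRows hr (Uᴴ * Z) = topRows hr Uᴴ * Z :=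
    fun _ => rfl
  have bot_mul : ∀ Z : Matrix (Fin n) (Fin n) 𝕜, botRows hr (Uᴴ * Z) = botRows hr Uᴴ * Z :=
    fun _ => rfl
  set DS := ΔD + (botRows hr Uᴴ)ᴴ * Γ₁ with hDS
  set ES := δE + ΔE + (topRows hr Uᴴ)ᴴ * Γ₂ with hES
  -- Orthogonality of the leading and trailing rows of `Uᴴ`: the correction by `Γ₁` leaves the
  -- stored block `X₁` intact, and likewise the correction by `Γ₂` below preserves the zero rows
  -- needed for deflation.
  have hDtop : topRows hr (Uᴴ * (D + DS)) = topRows hr X := by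
    rw [hDS, ← add_assoc, top_mul, Matrix.mul_add, ← Matrix.mul_assoc,
      topRows_mul_conjTranspose_botRows hr hUc, Matrix.zero_mul, add_zero, hD2, top_mul]
  have hDbot : botRows hr (Uᴴ * (D + DS)) = botRows hr X + Γ₁ := by
    rw [hDS, ← add_assoc, bot_mul, Matrix.mul_add, ← Matrix.mul_assoc,
      botRows_mul_conjTranspose_botRows hr hUc, Matrix.one_mul, hD2, bot_mul]
  have hEStop : topRows hr (Uᴴ * (E + ES)) = permCols (topRows hr T) πE.symm + Γ₂ := by
    rw [hES, ← add_assoc, ← add_assoc, top_mul, Matrix.mul_add, ← Matrix.mul_assoc,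
      topRows_mul_conjTranspose_topRows hr hUc, Matrix.one_mul, ← hEtop', top_mul]
  have hESbot : botRows hr (Uᴴ * (E + ES)) = 0 := by
    rw [hES, ← add_assoc, ← add_assoc, bot_mul, Matrix.mul_add, ← Matrix.mul_assoc,
      botRows_mul_conjTranspose_topRows hr hUc, Matrix.zero_mul, add_zero, ← bot_mul, hEbot']
  have hW := conjTranspose_omega₁_mul_omega₁ hr hU₂c
  -- The forward errors are the differences, with the signs of the pencil, between stored blocks and
  -- those produced by `U`, `U₂`. The last witness is the coupling block left by the identity in the
  -- deflated columns.
  refine ⟨U, U₂, δC, δD, δE, ΔC, ΔD, ΔE, DS, ES, Γ₁, Γ₂, topRows hr (Uᴴ - QEᴴ),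
    N₁ - omega₁ hr U₂ᴴ * botRows hr Y, N₂ - omega₁ hr U₂ᴴ * botRows hr Uᴴ,
    omega₂ hr (Q₂ᴴ - U₂ᴴ), fromRows 0 (-omega₁ hr U₂ᴴ), hU, hU₂, hQU, hQU₂, hD1, hD2, hC1, hC2,
    hC3, hC4, hD3, hD4, fun i => ?_, hEtop, hEbot, hE3, hE4, hE5, rfl, rfl, fun i => ?_, ?_, ?_,
    fun i => ?_, ?_, ?_, ?_⟩
  · exact (hE1 i).trans (mul_le_mul_of_nonneg_right h.kappa_le_delta (colNorm_nonneg _ _))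
  · rw [← colNorm_stack hr, hΓeq]
    refine (hΓ i).trans (mul_le_mul_of_nonneg_left ?_ (by linarith [h.delta_nonneg]))
    rw [hM, secondMatrix, colNorm_stack, colNorm_fromRows, colNorm_fromRows]
    -- The rows of `M` are among those of `Uᴴ (D + ΔD)` and `Uᴴ (E + δE + ΔE)`, whose columns keep
    -- their norms.
    have e1 : colNorm (botRows hr X) i ≤ colNorm (D + ΔD) i := by
      rw [← colNorm_mul_of_isometry hUc' (D + ΔD), ← hD2]
      exact colNorm_botRows_le hr X i
    have e2 : colNorm (permCols (topRows hr T) πE.symm) i ≤ colNorm (E + δE + ΔE) i := by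
      rw [← colNorm_mul_of_isometry hUc' (E + δE + ΔE), ← hEtop']
      exact colNorm_topRows_le hr _ i
    exact Real.sqrt_le_sqrt (add_le_add (pow_le_pow_left₀ (colNorm_nonneg _ _) e1 2)
      (pow_le_pow_left₀ (colNorm_nonneg _ _) e2 2))
  · refine (specNorm_le_frobNorm _).trans ((frobNorm_topRows_le hr _).trans ?_)
    rw [← neg_sub, frobNorm_neg]
    exact hQUc
  · exact (specNorm_le_frobNorm _).trans ((frobNorm_omega₂_le hr _).trans hQU₂c)
  · refine h.forward_error_colNorm hW (h.matMul (by simp) ?_ ?_ hN₁ i)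
    · refine (frobNorm_omega₁_le hr _).trans ?_
      rw [frobNorm_conjTranspose]
      exact h.frobNorm_le hU₂ hQU₂
    · exact (frobNorm_omega₁_le hr (Q₂ᴴ - U₂ᴴ)).trans hQU₂c
  · exact h.forward_error_specNorm hr hδ hUc hQUc hU₂c hQU₂c hN₂
  · rw [deflationTransform_linA hr hU' _ _ _ _ hESbot, hDtop, hDbot, hEStop, stack_add, hΓeq]
    rw [show stack hr (botRows hr X) (permCols (topRows hr T) πE.symm) = M from rfl,
      add_sub_cancel]
    rw [show U₂ᴴ * permCols (U₂ * keepRows r₂ T') π₂.symm =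
      permCols (U₂ᴴ * (U₂ * keepRows r₂ T')) π₂.symm from rfl, ← Matrix.mul_assoc, hU₂',
      Matrix.one_mul]
  · rw [deflationTransform_linB hr hU', redB_add_forwardPert, ← hC2, sub_sub_cancel,
      sub_sub_cancel]
    congr 2
    · rw [show topRows hr (Uᴴ - QEᴴ) = topRows hr Uᴴ - topRows hr QEᴴ from rfl, add_sub_cancel]
    · rw [show omega₂ hr (Q₂ᴴ - U₂ᴴ) = omega₂ hr Q₂ᴴ - omega₂ hr U₂ᴴ from rfl, neg_add_eq_sub,
        sub_sub_cancel_left]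


theorem mainTheorem2 {𝕜 : Type*} [RCLike 𝕜]
    (g : ℕ → ℝ) (hg : QuarticDeflation.MildlyGrowing g) :
    ∃ fC fD fqr f₁ f₂ h : ℕ → ℝ,
      QuarticDeflation.MildlyGrowing fC ∧ QuarticDeflation.MildlyGrowing fD ∧
      QuarticDeflation.MildlyGrowing fqr ∧ QuarticDeflation.MildlyGrowing f₁ ∧
      QuarticDeflation.MildlyGrowing f₂ ∧ QuarticDeflation.MildlyGrowing h ∧
      ∀ (n r r₂ : ℕ) (hr : r ≤ n) (_hr₂ : r₂ ≤ n) (ε thr : ℝ) (_hε : 0 ≤ ε) (_hsmall : h n * ε ≤ 1)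
        (_hthr : 0 ≤ thr)
        (A B C D E : Matrix (Fin n) (Fin n) 𝕜)
        -- computed quantities of the first step
        (πE : Equiv.Perm (Fin n)) (QE : Matrix (Fin n) (Fin n) 𝕜) (RE : Matrix (Fin r) (Fin n) 𝕜)
        (X Y : Matrix (Fin n) (Fin n) 𝕜)
        -- computed quantities of the second step
        (π₂ : Equiv.Perm (Fin n)) (Q₂ R₂ N₁ N₂ N₃ : Matrix (Fin n) (Fin n) 𝕜)
        (N₄ : Matrix (Fin n) (Fin r) 𝕜)
        (_h₁ : QuarticDeflation.ComputedFirstStep ε thr hr C D E πE QE RE X Y)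
        (_h₂ : QuarticDeflation.ComputedSecondStep ε (g n * ε) hr r₂ πE QE RE X Y π₂ Q₂ R₂
          N₁ N₂ N₃ N₄),
      -- exactly unitary matrices, backward errors, forward errors
      ∃ (QEhat Q₂hat δC δD δE ΔC ΔD ΔE DS ES : Matrix (Fin n) (Fin n) 𝕜)
        (Γ₁ : Matrix (Fin (n - r)) (Fin n) 𝕜) (Γ₂ : Matrix (Fin r) (Fin n) 𝕜)
        (dU : Matrix (Fin r) (Fin n) 𝕜) (dN₁ dN₂ : Matrix (Fin n) (Fin n) 𝕜)
        (dN₄ : Matrix (Fin n) (Fin r) 𝕜)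
        (S : Matrix (QuarticDeflation.RowIdx n r) (Fin (n - r)) 𝕜),
        QEhat ∈ Matrix.unitaryGroup (Fin n) 𝕜 ∧ Q₂hat ∈ Matrix.unitaryGroup (Fin n) 𝕜 ∧
        QuarticDeflation.frobNorm (QE - QEhat) ≤ fqr n * ε ∧
        QuarticDeflation.frobNorm (Q₂ - Q₂hat) ≤ fqr n * ε ∧
        -- the backward errors of the first step
        X = QE.conjTranspose * (D + δD) ∧ X = QEhat.conjTranspose * (D + ΔD) ∧
        Y = QE.conjTranspose * (C + δC) ∧ Y = QEhat.conjTranspose * (C + ΔC) ∧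
        (∀ i, QuarticDeflation.colNorm δC i ≤ fC n * ε * QuarticDeflation.colNorm C i) ∧
        (∀ i, QuarticDeflation.colNorm ΔC i ≤ fC n * ε * QuarticDeflation.colNorm C i) ∧
        (∀ i, QuarticDeflation.colNorm δD i ≤ fD n * ε * QuarticDeflation.colNorm D i) ∧
        (∀ i, QuarticDeflation.colNorm ΔD i ≤ fD n * ε * QuarticDeflation.colNorm D i) ∧
        (∀ i, QuarticDeflation.colNorm δE i ≤ fqr n * ε * QuarticDeflation.colNorm E i) ∧
        QuarticDeflation.topRows hr
            (QEhat.conjTranspose * QuarticDeflation.permCols (E + δE + ΔE) πE) = RE ∧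
        QuarticDeflation.botRows hr
            (QEhat.conjTranspose * QuarticDeflation.permCols (E + δE + ΔE) πE) = 0 ∧
        -- the truncation error of the first step
        (∀ i j : Fin n, (i : ℕ) < r → r ≤ (j : ℕ) →
          QuarticDeflation.colNorm (QuarticDeflation.permCols ΔE πE) j ≤
            thr * QuarticDeflation.colNorm (QuarticDeflation.permCols (E + δE) πE) i) ∧
        (∀ i j : Fin n, (j : ℕ) < r → QuarticDeflation.permCols ΔE πE i j = 0) ∧
        (r = 0 → ΔE = 0) ∧
        -- the accumulated backward errors in `D` and `E`
        DS = ΔD + (QuarticDeflation.botRows hr QEhat.conjTranspose).conjTranspose * Γ₁ ∧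
        ES = δE + ΔE + (QuarticDeflation.topRows hr QEhat.conjTranspose).conjTranspose * Γ₂ ∧
        (∀ i, QuarticDeflation.colNorm (Matrix.fromRows Γ₁ Γ₂) i ≤
          fqr n * ε * QuarticDeflation.colNorm (Matrix.fromRows (D + ΔD) (E + δE + ΔE)) i) ∧
        -- the forward perturbation is small
        QuarticDeflation.specNorm dU ≤ fqr n * ε ∧
        QuarticDeflation.specNorm dN₄ ≤ fqr n * ε ∧
        (∀ i, QuarticDeflation.colNorm dN₁ i ≤ f₁ n * ε * QuarticDeflation.colNorm N₁ i) ∧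
        QuarticDeflation.specNorm dN₂ ≤ f₂ n * ε * QuarticDeflation.specNorm N₂ ∧
        -- the computed pencil plus the forward perturbation is an exactly reduced linearization
        -- of the perturbed quartic
        QuarticDeflation.deflationTransform hr QEhat Q₂hat
            (QuarticDeflation.linA B (D + DS) (E + ES)) =
          Matrix.fromBlocks
            (QuarticDeflation.redA B (QuarticDeflation.topRows hr X)
              (QuarticDeflation.permCols R₂ π₂.symm))
            S 0 0 ∧
        QuarticDeflation.deflationTransform hr QEhat Q₂hat
            (QuarticDeflation.linB A (C + ΔC)) =
          Matrix.fromBlocks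
            (QuarticDeflation.redB A (QuarticDeflation.topRows hr Y)
                (QuarticDeflation.topRows hr QE.conjTranspose) N₁ N₂ N₃ N₄ +
              QuarticDeflation.forwardPert dU dN₁ dN₂ dN₄)
            0 0 (-1) := by
  -- With `δ = 400 N³ ε`, `N = n + 1`: `1600` comes from `4 δ`, the term `2 g` from the discarded
  -- part of the second factorization, and `4000 N⁴` from `2 δ (2 √n + 3)` with `2 √n + 3 ≤ 5 N`.
  refine ⟨fun n => 1600 * ((n : ℝ) + 1) ^ 3, fun n => 1600 * ((n : ℝ) + 1) ^ 3,
    fun n => 400 * ((n : ℝ) + 1) ^ 3 + 2 * g n, fun n => 1600 * ((n : ℝ) + 1) ^ 3,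
    fun n => 4000 * ((n : ℝ) + 1) ^ 4, fun n => 40000 * ((n : ℝ) + 1) ^ 4,
    .monomial (by norm_num) 3, .monomial (by norm_num) 3,
    (QuarticDeflation.MildlyGrowing.monomial (by norm_num) 3).add (hg.const_mul zero_le_two),
    .monomial (by norm_num) 3, .monomial (by norm_num) 4, .monomial (by norm_num) 4, ?_⟩
  intro n r r₂ hr _ ε thr hε hsmall hthr A B C D E πE QE RE X Y π₂ Q₂ R₂ N₁ N₂ N₃ N₄ h₁ h₂
  have hg0 : 0 ≤ g n * ε := mul_nonneg (hg.choose_spec.choose_spec n).1 hε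
  have hlev := QuarticDeflation.errorLevels_of_small hε hsmall
  have hs := QuarticDeflation.sqrt_natCast_le_add_one n
  have hle : 400 * ((n : ℝ) + 1) ^ 3 * ε * (2 * √n + 3) ≤ 2000 * ((n : ℝ) + 1) ^ 4 * ε := by
    have h3 : 0 ≤ 400 * ((n : ℝ) + 1) ^ 3 * ε := by positivity
    have := mul_le_mul_of_nonneg_left (show 2 * √n + 3 ≤ 5 * ((n : ℝ) + 1) by
      linarith [Nat.cast_nonneg (α := ℝ) n]) h3
    linarith
  obtain ⟨U, U₂, δC, δD, δE, ΔC, ΔD, ΔE, DS, ES, Γ₁, Γ₂, dU, dN₁, dN₂, dN₄, S, a1, a2, a3, a4, a5,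
    a6, a7, a8, a9, a10, a11, a12, a13, a14, a15, a16, a17, a18, a19, a20, a21, a22, a23, a24, a25,
    a26, a27⟩ := hlev.mixed_stable_deflation (A := A) (B := B) hr hthr hg0 (by linarith) h₁ h₂
  have hδ : 400 * ((n : ℝ) + 1) ^ 3 * ε ≤ (400 * ((n : ℝ) + 1) ^ 3 + 2 * g n) * ε := by linarith
  have h4 : 4 * (400 * ((n : ℝ) + 1) ^ 3 * ε) = 1600 * ((n : ℝ) + 1) ^ 3 * ε := by ring
  have h5 : 400 * ((n : ℝ) + 1) ^ 3 * ε + 2 * (g n * ε) =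
    (400 * ((n : ℝ) + 1) ^ 3 + 2 * g n) * ε := by ring
  rw [h4] at a9 a10 a11 a12 a24
  rw [h5] at a21
  exact ⟨U, U₂, δC, δD, δE, ΔC, ΔD, ΔE, DS, ES, Γ₁, Γ₂, dU, dN₁, dN₂, dN₄, S, a1, a2,
    a3.trans hδ, a4.trans hδ, a5, a6, a7, a8, a9, a10, a11, a12,
    fun i => (a13 i).trans
      (mul_le_mul_of_nonneg_right hδ (QuarticDeflation.colNorm_nonneg _ _)),
    a14, a15, a16, a17, a18, a19, a20, a21, a22.trans hδ, a23.trans hδ, a24,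
    a25.trans (mul_le_mul_of_nonneg_right (by linarith) (QuarticDeflation.specNorm_nonneg _)),
    a26, a27⟩
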